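/- For $p\in\mathbb{R}[x]$ let $\mathscr{W}(p)\in\mathbb{R}[x]$ be the polynomial of degree at most $\deg p$ defined by \[\sum_{j\ge 0}p(j)\,x^j=\frac{\mathscr{W}(p)(x)}{(1-x)^{\deg p+1}}.\] For a polynomial $h$ of degree at most $d$ there are unique polynomials $a,b$ with $\deg a\le d$, $\deg b\le d-1$ such that $h(x)=a(x)+x\,b(x)$, $a(x)=x^{d}a(1/x)$ and $b(x)=x^{d-1}b(1/x)$ (for $d=0$ this means $b=0$); the pair $(a,b)$ is called the symmetric decomposition of $h$ with respect to $d$. For $h=\mathscr{W}(p)$ it is always taken with respect to $d=\deg p$ (with $d=0$ if $p=0$). The decomposition is called nonnegative if all coefficients of $a$ and $b$ are nonnegative, and interlacing if $b$ interlaces $a$, written $b\preceq a$. Here $b\preceq a$ means that $a$ and $b$ have only real zeros and that their zeros, counted with multiplicity, $s_k\le\cdots\le s_1$ of $a$ and $t_m\le\cdots\le t_1$ of $b$, satisfy $\cdots\le t_2\le s_2\le t_1\le s_1$ (in particular $m\le k\le m+1$); by convention, the zero polynomial is real-rooted, and $0\preceq f$ and $f\preceq 0$ for every real-rooted polynomial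 $f$. **Theorem 1.5.** Let $p,q\in\mathbb{R}[x]$ be such that $\mathscr{W}(p)$ and $\mathscr{W}(q)$ have nonnegative, interlacing symmetric decompositions. Then $\mathscr{W}(pq)$ also has a nonnegative, interlacing symmetric decomposition. -/

import Mathlib

open Polynomial

/-- The numerator polynomial of a real polynomial `p`: the polynomial `W p` with
`∑ p(j) x^j = W p / (1 - x)^(deg p + 1)`. It is obtained from the power series
`(1 - x)^(deg p + 1) * ∑ p(j) x^j` by reading off its coefficients up to degree `deg p`;
`coe_numeratorPoly` shows that all further coefficients vanish, so that nothing is cut off. -/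
noncomputable def numeratorPoly (p : ℝ[X]) : ℝ[X] :=
  PowerSeries.trunc (p.natDegree + 1)
    ((1 - PowerSeries.X) ^ (p.natDegree + 1) * PowerSeries.mk fun j : ℕ => p.eval (j : ℝ))

/-- The numerator polynomial is indeed the numerator of the generating function of `p`. -/
theorem coe_numeratorPoly (p : ℝ[X]) :
    (numeratorPoly p : PowerSeries ℝ) =
      (1 - PowerSeries.X) ^ (p.natDegree + 1) * PowerSeries.mk fun j : ℕ => p.eval (j : ℝ) := by
  have key : ∀ k n : ℕ, PowerSeries.coeff (n + k)
      ((1 - PowerSeries.X) ^ k * PowerSeries.mk fun j : ℕ => p.eval (j : ℝ)) =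
        (fwdDiff (1 : ℝ))^[k] (fun x => p.eval x) (n : ℝ) := by
    intro k
    induction k with
    | zero => intro n; simp
    | succ k ih =>
      intro n
      have h1 := ih (n + 1)
      have h0 := ih n
      rw [pow_succ', mul_assoc, sub_mul, one_mul, map_sub, ← add_assoc,
        PowerSeries.coeff_succ_X_mul, Function.iterate_succ_apply', fwdDiff, h0,
        show n + k + 1 = n + 1 + k by ring, h1]
      push_cast
      rfl
  ext n
  rw [numeratorPoly, Polynomial.coeff_coe, PowerSeries.coeff_trunc]
  split_ifs with hn
  · rfl
  · obtain ⟨m, rfl⟩ := Nat.exists_eq_add_of_le' (not_lt.mp hn)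
    rw [key, Polynomial.fwdDiff_iter_degree_add_one_eq_zero]
    rfl

/-- The pair `(a, b)` is the symmetric decomposition of `h` with respect to `d`:
`h = a + x b`, where `a` has degree at most `d` and `x^d a(1/x) = a`, and `b` has degree at most
`d - 1` and `x^(d-1) b(1/x) = b`. For `d = 0` the condition `b.degree < d` says `b = 0`. -/
structure IsSymmDecomp (d : ℕ) (h a b : ℝ[X]) : Prop where
  eq_add : h = a + X * b
  degree_left : a.degree ≤ d
  reflect_left : a.reflect d = a
  degree_right : b.degree < d
  reflect_right : b.reflect (d - 1) = b

/-- The zeros of a polynomial, listed with multiplicity in weakly decreasing order. -/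
noncomputable def zerosDesc (a : ℝ[X]) : List ℝ := a.roots.sort (· ≥ ·)

/-- `b` interlaces `a`: both are real-rooted, and their zeros `s₁ ≥ s₂ ≥ ⋯` (of `a`) and
`t₁ ≥ t₂ ≥ ⋯` (of `b`) satisfy `⋯ ≤ t₂ ≤ s₂ ≤ t₁ ≤ s₁`. The zero polynomial counts as real-rooted,
and interlaces and is interlaced by every real-rooted polynomial. -/
def Interlaces (b a : ℝ[X]) : Prop :=
  b.Splits ∧ a.Splits ∧
    (b = 0 ∨ a = 0 ∨
      ((zerosDesc b).length ≤ (zerosDesc a).length ∧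
        (zerosDesc a).length ≤ (zerosDesc b).length + 1 ∧
        (∀ (i : ℕ) (ha : i < (zerosDesc a).length) (hb : i < (zerosDesc b).length),
          (zerosDesc b)[i] ≤ (zerosDesc a)[i]) ∧
        (∀ (i : ℕ) (ha : i + 1 < (zerosDesc a).length) (hb : i < (zerosDesc b).length),
          (zerosDesc a)[i + 1] ≤ (zerosDesc b)[i])))

/-- The symmetric decomposition `(a, b)` of `h` with respect to `d` is nonnegative (both `a` and
`b` have only nonnegative coefficients) and interlacing (`b` interlaces `a`). -/
def HasNonnegInterlacingSymmDecomp (d : ℕ) (h : ℝ[X]) : Prop :=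
  ∃ a b : ℝ[X], IsSymmDecomp d h a b ∧
    (∀ i, 0 ≤ a.coeff i) ∧ (∀ i, 0 ≤ b.coeff i) ∧ Interlaces b a

/-! Expand `p` in binomial coefficients, `p(x) = ∑ f_k (x choose k)`. Then `∑ f_k x^k` is the lift
`(1 + x)^d W(p)(x / (1 + x))` of the numerator, and the product `p q` becomes the bilinear `diamond`
product of the lifts (`numeratorPoly_mul_eq`).

For `W(p) = a + x b` the reversed polynomial is `a + b`. Let `f₂`, `f₁` be the lifts of `a + x b`
and `a + b`. Under `t = x / (1 + x)` the map `t ↦ 1 / t` becomes `x ↦ -1 - x`, so `f₁(x) = (-1)^d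
f₂(-1 - x)`. If the decomposition is nonnegative and interlacing, both lifts have all zeros in `[-1,
0]` and `f₁` interlaces `f₂` (`IsSymmDecomp.exists_isInterlacingPair`); `IsSymmPair.exists_decomp`
is the way back. It remains to see that `diamond` preserves such pairs.

Interlacing is handled analytically: for real-rooted polynomials with nonnegative coefficients, `b ⪯
a` means `Im (a * conj b) ≥ 0` on the upper half-plane, a condition that is linear in each
polynomial. By `Interleaved.cone_induction`, `f₁` lies in the convex cone generated by `f₂` and the
polynomials `(x + 1) f₂ / (x - s)`, `s` a zero of `f₂`. Bilinearity reduces the claim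
`IsInterlacingPair.im_diamond_nonneg` to these generators, where it follows from `IsStable.diamond`:
the diamond product of a polynomial with zeros in `[-1, 0]` and a stable polynomial is stable.
Nonnegativity comes from explicit subtraction-free formulas (`IsSymmPair.diamond`). -/

/-! ### The diamond product and its recursions. -/

section Diamond

variable {R : Type*} [CommRing R]

/-- The diamond product `∑ k, (x (x + 1))^k f^(k) g^(k) / k!^2`, which corresponds to the product
of polynomial functions in the basis of binomial coefficients. -/
noncomputable def diamond (f g : R[X]) : R[X] :=
  ∑ k ∈ Finset.range (f.natDegree + 1), (X * (X + 1)) ^ k * (hasseDeriv k f * hasseDeriv k g)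

/-- The difference between `diamond (X * f) g` and `X * diamond f g`. -/
noncomputable def diamondStep (f g : R[X]) : R[X] :=
  ∑ k ∈ Finset.range (f.natDegree + 1),
    (X * (X + 1)) ^ (k + 1) * (hasseDeriv k f * hasseDeriv (k + 1) g)

theorem diamond_eq_sum {f : R[X]} (g : R[X]) {N : ℕ} (h : f.natDegree < N) :
    diamond f g =
      ∑ k ∈ Finset.range N, (X * (X + 1)) ^ k * (hasseDeriv k f * hasseDeriv k g) := by
  refine Finset.sum_subset (fun k hk => ?_) fun k _ hk => ?_
  · simp only [Finset.mem_range] at *; omega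
  · rw [hasseDeriv_eq_zero_of_lt_natDegree _ _ (by simpa using hk)]; simp

theorem diamond_comm (f g : R[X]) : diamond f g = diamond g f := by
  rw [diamond_eq_sum (N := f.natDegree + g.natDegree + 1) g (by omega),
    diamond_eq_sum (N := f.natDegree + g.natDegree + 1) f (by omega)]
  exact Finset.sum_congr rfl fun k _ => by rw [mul_comm (hasseDeriv k f)]

theorem diamond_add_right (f g₁ g₂ : R[X]) :
    diamond f (g₁ + g₂) = diamond f g₁ + diamond f g₂ := by
  simp only [diamond, map_add, mul_add, Finset.sum_add_distrib]

theorem diamond_add_left (f₁ f₂ g : R[X]) :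
    diamond (f₁ + f₂) g = diamond f₁ g + diamond f₂ g := by
  rw [diamond_comm, diamond_add_right, diamond_comm g f₁, diamond_comm g f₂]

theorem diamond_C_mul_right (c : R) (f g : R[X]) :
    diamond f (C c * g) = C c * diamond f g := by
  simp only [diamond, ← smul_eq_C_mul, map_smul, mul_smul_comm, Finset.smul_sum]

theorem diamond_C_mul_left (c : R) (f g : R[X]) :
    diamond (C c * f) g = C c * diamond f g := by
  rw [diamond_comm, diamond_C_mul_right, diamond_comm]

theorem diamond_sub_right (f g₁ g₂ : R[X]) :
    diamond f (g₁ - g₂) = diamond f g₁ - diamond f g₂ := by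
  simp only [diamond, map_sub, mul_sub, Finset.sum_sub_distrib]

theorem diamond_sub_left (f₁ f₂ g : R[X]) :
    diamond (f₁ - f₂) g = diamond f₁ g - diamond f₂ g := by
  rw [diamond_comm, diamond_sub_right, diamond_comm g f₁, diamond_comm g f₂]

@[simp] theorem diamond_zero_left (g : R[X]) : diamond 0 g = 0 := by simp [diamond]

@[simp] theorem diamond_zero_right (f : R[X]) : diamond f 0 = 0 := by simp [diamond]

@[simp] theorem diamond_one_left (g : R[X]) : diamond 1 g = g := by simp [diamond]

theorem diamond_C_left (c : R) (g : R[X]) : diamond (C c) g = C c * g := by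
  rw [← mul_one (C c), diamond_C_mul_left, diamond_one_left, mul_one]

theorem diamond_C_right (f : R[X]) (c : R) : diamond f (C c) = C c * f := by
  rw [diamond_comm, diamond_C_left]

theorem hasseDeriv_succ_X_mul (k : ℕ) (f : R[X]) :
    hasseDeriv (k + 1) (X * f) = X * hasseDeriv (k + 1) f + hasseDeriv k f := by
  ext n
  rcases n with _ | n
  · simp [hasseDeriv_coeff, coeff_X_mul]
  · simp only [hasseDeriv_coeff, coeff_add, coeff_X_mul, ← add_assoc]
    rw [show n + 1 + k = n + k + 1 by ring, Nat.choose_succ_succ' (n + k + 1) k]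
    push_cast
    ring

theorem diamond_X_mul_left (f g : R[X]) :
    diamond (X * f) g = X * diamond f g + diamondStep f g := by
  have hd : (X * f).natDegree ≤ 1 + f.natDegree :=
    natDegree_mul_le.trans (Nat.add_le_add_right natDegree_X_le _)
  rw [diamond_eq_sum (N := f.natDegree + 1 + 1) g (by omega),
    diamond_eq_sum (f := f) (N := f.natDegree + 1 + 1) g (by omega), diamondStep,
    Finset.sum_range_succ', Finset.sum_range_succ' _ (f.natDegree + 1), mul_add X (Finset.sum _ _),
    Finset.mul_sum, add_right_comm, ← Finset.sum_add_distrib]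
  congr 1
  · refine Finset.sum_congr rfl fun k _ => ?_
    rw [hasseDeriv_succ_X_mul]
    ring
  · simp [mul_assoc]

theorem diamond_X_mul_right (f g : R[X]) :
    diamond f (X * g) = X * diamond f g + diamondStep g f := by
  rw [diamond_comm, diamond_X_mul_left, diamond_comm]

theorem diamondStep_X_mul_right (f g : R[X]) :
    diamondStep f (X * g) = X * diamondStep f g + X * (X + 1) * diamond f g := by
  rw [diamondStep, diamondStep, diamond, Finset.mul_sum, Finset.mul_sum,
    ← Finset.sum_add_distrib]
  refine Finset.sum_congr rfl fun k _ => ?_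
  rw [hasseDeriv_succ_X_mul]
  ring

theorem diamond_X_mul_X_mul (f g : R[X]) :
    diamond (X * f) (X * g) =
      X * (diamond f g + diamond (X * f) g + diamond f (X * g)) := by
  rw [diamond_X_mul_left f (X * g), diamondStep_X_mul_right, diamond_X_mul_left f g]
  ring

/-- The bracket is the same as in `diamond_X_mul_X_mul`; only the factor `X` becomes `X + 1`. This
makes `newtonShift` multiplicative, and later makes the quotient of the two products equal to `x /
(x + 1)`. -/
theorem diamond_X_add_one_mul (f g : R[X]) :
    diamond ((X + 1) * f) ((X + 1) * g) =
      (X + 1) * (diamond f g + diamond (X * f) g + diamond f (X * g)) := by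
  rw [add_mul, add_mul, one_mul, one_mul, diamond_add_left, diamond_add_right,
    diamond_add_right, diamond_X_mul_X_mul]
  ring

theorem diamond_map {S : Type*} [CommRing S] (i : R →+* S) (f g : R[X]) :
    diamond (f.map i) (g.map i) = (diamond f g).map i := by
  have hm : ∀ (k : ℕ) (p : R[X]), hasseDeriv k (p.map i) = (hasseDeriv k p).map i := by
    intro k p
    ext n
    simp [hasseDeriv_coeff]
  rw [diamond_eq_sum (N := f.natDegree + 1) (g.map i)
    (Nat.lt_succ_of_le natDegree_map_le), diamond, Polynomial.map_sum]
  simp [hm]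

theorem coeff_zero_diamond (f g : R[X]) :
    (diamond f g).coeff 0 = f.coeff 0 * g.coeff 0 := by
  simp only [coeff_zero_eq_eval_zero]
  rw [diamond, Finset.sum_range_succ', eval_add, eval_finsetSum]
  simp

end Diamond

/-! ### Compatibility of the diamond product with `x ↦ -1 - x`. -/

section Reflection

theorem hasseDeriv_comp_neg_one_sub_X (k : ℕ) (f : ℝ[X]) :
    hasseDeriv k (f.comp (-1 - X)) = (-1) ^ k * (hasseDeriv k f).comp (-1 - X) := by
  have h : ∀ k : ℕ, derivative^[k] (f.comp (-1 - X)) =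
      (-1) ^ k * (derivative^[k] f).comp (-1 - X) := by
    intro k
    induction k with
    | zero => simp
    | succ k ih =>
      rw [Function.iterate_succ_apply', ih, Function.iterate_succ_apply', pow_succ,
        show ((-1 : ℝ[X]) ^ k) = C ((-1) ^ k) by simp, derivative_C_mul, derivative_comp]
      simp
  have hk := h k
  rw [← factorial_smul_hasseDeriv] at hk
  simp only [LinearMap.smul_apply, smul_comp, mul_smul_comm] at hk
  exact (smul_right_injective _ (Nat.factorial_ne_zero k)) hk

theorem diamond_comp_neg_one_sub_X (f g : ℝ[X]) :
    diamond (f.comp (-1 - X)) (g.comp (-1 - X)) = (diamond f g).comp (-1 - X) := by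
  have hd : (f.comp (-1 - X)).natDegree ≤ f.natDegree := by
    refine natDegree_comp_le.trans ?_
    have : (-1 - X : ℝ[X]).natDegree ≤ 1 := by compute_degree
    nlinarith
  rw [diamond_eq_sum (N := f.natDegree + 1) _ (by omega), diamond, Polynomial.sum_comp]
  refine Finset.sum_congr rfl fun k _ => ?_
  rw [hasseDeriv_comp_neg_one_sub_X, hasseDeriv_comp_neg_one_sub_X]
  simp only [mul_comp, pow_comp, add_comp, X_comp, one_comp]
  have : ((-1 : ℝ[X]) ^ k) * (-1) ^ k = 1 := by rw [← mul_pow]; simp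
  rw [show (-1 - X) * (-1 - X + 1) = X * (X + 1 : ℝ[X]) by ring]
  linear_combination ((X * (X + 1)) ^ k * ((hasseDeriv k f).comp (-1 - X) *
    (hasseDeriv k g).comp (-1 - X))) * this

end Reflection

/-! ### The substitution `x / (1 + x)`. -/

section Lift

/-- The polynomial `(1 + x)^d h(x / (1 + x))`, for `h` of degree at most `d`. -/
noncomputable def lift (d : ℕ) (h : ℝ[X]) : ℝ[X] :=
  ∑ i ∈ Finset.range (d + 1), C (h.coeff i) * (X ^ i * (X + 1) ^ (d - i))

theorem lift_add (d : ℕ) (h k : ℝ[X]) : lift d (h + k) = lift d h + lift d k := by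
  simp [lift, add_mul, Finset.sum_add_distrib]

theorem lift_C_mul (d : ℕ) (c : ℝ) (h : ℝ[X]) : lift d (C c * h) = C c * lift d h := by
  simp [lift, Finset.mul_sum, mul_assoc]

@[simp] theorem lift_zero (d : ℕ) : lift d 0 = 0 := by simp [lift]

theorem lift_succ_X_mul (d : ℕ) (h : ℝ[X]) : lift (d + 1) (X * h) = X * lift d h := by
  rw [lift, Finset.sum_range_succ', lift, Finset.mul_sum]
  simp only [coeff_X_mul, Nat.reduceSubDiff, mul_coeff_zero, coeff_X_zero, zero_mul, map_zero,
    add_zero]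
  exact Finset.sum_congr rfl fun i _ => by ring

theorem lift_succ (d : ℕ) {h : ℝ[X]} (hd : h.natDegree ≤ d) :
    lift (d + 1) h = (X + 1) * lift d h := by
  rw [lift, Finset.sum_range_succ, coeff_eq_zero_of_natDegree_lt (by omega), lift,
    Finset.mul_sum]
  simp only [map_zero, zero_mul, add_zero]
  refine Finset.sum_congr rfl fun i hi => ?_
  rw [show d + 1 - i = d - i + 1 by have := Finset.mem_range.1 hi; omega]
  ring

theorem aeval_lift {d : ℕ} {h : ℝ[X]} (hd : h.natDegree ≤ d) (z : ℂ) (hz : z + 1 ≠ 0) :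
    aeval z (lift d h) = (z + 1) ^ d * aeval (z / (z + 1)) h := by
  rw [aeval_eq_sum_range' (p := h) (n := d + 1) (by omega), lift, map_sum, Finset.mul_sum]
  refine Finset.sum_congr rfl fun i hi => ?_
  have : d = i + (d - i) := by have := Finset.mem_range.1 hi; omega
  rw [show (z + 1) ^ d = (z + 1) ^ i * (z + 1) ^ (d - i) by rw [← pow_add, ← this], div_pow]
  simp only [map_mul, aeval_C, map_pow, aeval_X, map_add, map_one, Algebra.smul_def]
  field_simp

theorem lift_reflect (d : ℕ) (h : ℝ[X]) :
    lift d (h.reflect d) = (-1) ^ d * (lift d h).comp (-1 - X) := by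
  rw [lift, ← Finset.sum_range_reflect, lift, Polynomial.sum_comp, Finset.mul_sum]
  refine Finset.sum_congr rfl fun i hi => ?_
  have hi := Finset.mem_range.1 hi
  rw [coeff_reflect, revAt_le (by omega), show d - (d + 1 - 1 - i) = i by omega,
    show d + 1 - 1 - i = d - i by omega]
  simp only [mul_comp, C_comp, pow_comp, X_comp, add_comp, one_comp]
  rw [show (-1 - X + 1 : ℝ[X]) = (-1) * X by ring, show (-1 - X : ℝ[X]) = (-1) * (X + 1) by ring,
    mul_pow, mul_pow]
  have : ((-1 : ℝ[X]) ^ d) * ((-1) ^ i * (-1) ^ (d - i)) = 1 := by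
    rw [← pow_add, show i + (d - i) = d by omega, ← mul_pow]; simp
  linear_combination (-(C (h.coeff i) * (X + 1) ^ i * X ^ (d - i))) * this

end Lift

/-! ### The cone of lifts of polynomials with nonnegative coefficients. -/

section Cone

/-- `f` is a nonnegative combination of the polynomials `x^i (1 + x)^(d - i)`, `i ≤ d`. -/
def IsNonnegLift (d : ℕ) (f : ℝ[X]) : Prop :=
  ∃ h : ℝ[X], h.natDegree ≤ d ∧ (∀ i, 0 ≤ h.coeff i) ∧ f = lift d h

theorem lift_X_pow {i d : ℕ} (hi : i ≤ d) : lift d (X ^ i) = X ^ i * (X + 1) ^ (d - i) := by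
  rw [lift, Finset.sum_eq_single i]
  · simp
  · intro b _ hb
    simp [coeff_X_pow, hb]
  · intro h
    exact absurd (Finset.mem_range.2 (by omega)) h

namespace IsNonnegLift

variable {d e : ℕ} {f g : ℝ[X]}

theorem zero (d : ℕ) : IsNonnegLift d 0 := ⟨0, by simp, by simp, by simp⟩

theorem add (hf : IsNonnegLift d f) (hg : IsNonnegLift d g) : IsNonnegLift d (f + g) := by
  obtain ⟨h, h1, h2, rfl⟩ := hf
  obtain ⟨k, k1, k2, rfl⟩ := hg
  exact ⟨h + k, natDegree_add_le_of_degree_le h1 k1,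
    fun i => by rw [coeff_add]; exact add_nonneg (h2 i) (k2 i), (lift_add _ _ _).symm⟩

theorem C_mul {c : ℝ} (hc : 0 ≤ c) (hf : IsNonnegLift d f) : IsNonnegLift d (C c * f) := by
  obtain ⟨h, h1, h2, rfl⟩ := hf
  exact ⟨C c * h, (natDegree_C_mul_le _ _).trans h1,
    fun i => by rw [coeff_C_mul]; exact mul_nonneg hc (h2 i), (lift_C_mul _ _ _).symm⟩

theorem sum {ι : Type*} (s : Finset ι) {F : ι → ℝ[X]} (h : ∀ i ∈ s, IsNonnegLift d (F i)) :
    IsNonnegLift d (∑ i ∈ s, F i) :=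
  Finset.sum_induction F (IsNonnegLift d) (fun _ _ => add) (zero d) h

theorem monomial (i j : ℕ) : IsNonnegLift (i + j) (X ^ i * (X + 1) ^ j) := by
  refine ⟨X ^ i, by simp, fun k => ?_, ?_⟩
  · rw [coeff_X_pow]; split_ifs <;> simp
  · rw [lift_X_pow (by omega), Nat.add_sub_cancel_left]

theorem mul (hf : IsNonnegLift d f) (hg : IsNonnegLift e g) : IsNonnegLift (d + e) (f * g) := by
  obtain ⟨h, h1, h2, rfl⟩ := hf
  obtain ⟨k, k1, k2, rfl⟩ := hg
  rw [lift, lift, Finset.sum_mul_sum]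
  refine sum _ fun i hi => sum _ fun j hj => ?_
  have hi := Finset.mem_range.1 hi
  have hj := Finset.mem_range.1 hj
  have := (monomial (i + j) (d - i + (e - j))).C_mul (mul_nonneg (h2 i) (k2 j))
  rw [show i + j + (d - i + (e - j)) = d + e by omega] at this
  convert this using 1
  rw [_root_.map_mul]
  ring

theorem X_mul (hf : IsNonnegLift d f) : IsNonnegLift (d + 1) (X * f) := by
  simpa [add_comm] using (monomial 1 0).mul hf

theorem X_add_one_mul (hf : IsNonnegLift d f) : IsNonnegLift (d + 1) ((X + 1) * f) := by
  simpa [add_comm] using (monomial 0 1).mul hf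

theorem pow_mul (k : ℕ) (hf : IsNonnegLift d f) :
    IsNonnegLift (k + k + d) ((X * (X + 1)) ^ k * f) := by
  rw [_root_.mul_pow]
  exact (monomial k k).mul hf

/-- Both terms of the product rule have the same shape with total degree one less. Hence Hasse
derivatives preserve the cone, and the factors `(x (x + 1))^k` in `diamond` restore the lost degree.
-/
theorem derivative_monomial (i j : ℕ) :
    IsNonnegLift (i + j - 1) (derivative (X ^ i * (X + 1) ^ j)) := by
  have e1 : derivative (X ^ i * (X + 1) ^ j : ℝ[X]) =
      C (i : ℝ) * (X ^ (i - 1) * (X + 1) ^ j) + C (j : ℝ) * (X ^ i * (X + 1) ^ (j - 1)) := by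
    simp [derivative_mul, derivative_pow]
    ring
  rw [e1]
  refine add ?_ ?_
  · rcases Nat.eq_zero_or_pos i with rfl | hi
    · simpa using zero _
    · rw [show i + j - 1 = i - 1 + j by omega]
      exact (monomial _ _).C_mul (by positivity)
  · rcases Nat.eq_zero_or_pos j with rfl | hj
    · simpa using zero _
    · rw [show i + j - 1 = i + (j - 1) by omega]
      exact (monomial _ _).C_mul (by positivity)

theorem derivative (hf : IsNonnegLift d f) : IsNonnegLift (d - 1) (derivative f) := by
  obtain ⟨h, h1, h2, rfl⟩ := hf
  rw [lift, _root_.map_sum]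
  refine sum _ fun i hi => ?_
  rw [derivative_C_mul]
  have := derivative_monomial i (d - i)
  rw [show i + (d - i) = d by have := Finset.mem_range.1 hi; omega] at this
  exact this.C_mul (h2 i)

theorem hasseDeriv (k : ℕ) (hf : IsNonnegLift d f) : IsNonnegLift (d - k) (hasseDeriv k f) := by
  have h : IsNonnegLift (d - k) (Polynomial.derivative^[k] f) := by
    induction k with
    | zero => exact hf
    | succ k ih =>
      rw [Function.iterate_succ_apply', ← Nat.sub_sub]
      exact ih.derivative
  rw [← factorial_smul_hasseDeriv] at h
  have h' := h.C_mul (c := ((k.factorial : ℝ))⁻¹) (by positivity)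
  have hk : (k.factorial : ℝ) ≠ 0 := by positivity
  convert h' using 1
  rw [LinearMap.smul_apply, nsmul_eq_mul, ← mul_assoc, ← C_eq_natCast, ← _root_.map_mul,
    inv_mul_cancel₀ hk, _root_.map_one, one_mul]

theorem natDegree_le (hf : IsNonnegLift d f) : f.natDegree ≤ d := by
  obtain ⟨h, h1, h2, rfl⟩ := hf
  refine natDegree_sum_le_of_forall_le _ _ fun i hi => ?_
  have := Finset.mem_range.1 hi
  refine (natDegree_C_mul_le _ _).trans (natDegree_mul_le.trans ?_)
  have h3 : ((X + 1 : ℝ[X]) ^ (d - i)).natDegree ≤ (d - i) * 1 :=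
    natDegree_pow_le_of_le _ (by compute_degree)
  have h4 : ((X : ℝ[X]) ^ i).natDegree ≤ i := natDegree_X_pow_le _
  omega

theorem diamond (hf : IsNonnegLift d f) (hg : IsNonnegLift e g) :
    IsNonnegLift (d + e) (diamond f g) := by
  refine sum _ fun k _ => ?_
  -- The degree count fails under truncated subtraction once `k` exceeds `d` or `e`, but then a
  -- Hasse derivative vanishes.
  by_cases hk : k ≤ d ∧ k ≤ e
  · have := ((hf.hasseDeriv k).mul (hg.hasseDeriv k)).pow_mul k
    rwa [show k + k + (d - k + (e - k)) = d + e by omega] at this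
  · convert zero _
    rcases not_and_or.1 hk with hk | hk
    · rw [hasseDeriv_eq_zero_of_lt_natDegree f k (by have := hf.natDegree_le; omega)]; simp
    · rw [hasseDeriv_eq_zero_of_lt_natDegree g k (by have := hg.natDegree_le; omega)]; simp

theorem diamondStep (hf : IsNonnegLift d f) (hg : IsNonnegLift e g) :
    IsNonnegLift (d + 1 + e) (diamondStep f g) := by
  refine sum _ fun k _ => ?_
  by_cases hk : k ≤ d ∧ k + 1 ≤ e
  · have := ((hf.hasseDeriv k).mul (hg.hasseDeriv (k + 1))).pow_mul (k + 1)
    rwa [show k + 1 + (k + 1) + (d - k + (e - (k + 1))) = d + 1 + e by omega] at this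
  · convert zero _
    rcases not_and_or.1 hk with hk | hk
    · rw [hasseDeriv_eq_zero_of_lt_natDegree f k (by have := hf.natDegree_le; omega)]; simp
    · rw [hasseDeriv_eq_zero_of_lt_natDegree g (k + 1) (by have := hg.natDegree_le; omega)]
      simp

theorem eval_pos (hf : IsNonnegLift d f) (h0 : f ≠ 0) {x : ℝ} (hx : 0 < x) : 0 < f.eval x := by
  obtain ⟨h, h1, h2, rfl⟩ := hf
  have hh : h ≠ 0 := by rintro rfl; simp at h0
  rw [lift, eval_finsetSum]
  refine Finset.sum_pos' (fun i _ => ?_) ⟨h.natDegree, Finset.mem_range.2 (by omega), ?_⟩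
  · have := h2 i
    simp only [eval_mul, eval_C, eval_pow, eval_X, eval_add, eval_one]
    positivity
  · have : 0 < h.coeff h.natDegree :=
      lt_of_le_of_ne (h2 _) (Ne.symm (by simpa using hh))
    simp only [eval_mul, eval_C, eval_pow, eval_X, eval_add, eval_one]
    positivity

end IsNonnegLift

/-- Each `x^i (x + 1)^(d - i)` is monic of degree `d`, so no leading terms can cancel in a nonzero
nonnegative lift: its degree is exactly `d`. -/
theorem coeff_lift (d : ℕ) {h : ℝ[X]} (hd : h.natDegree ≤ d) :
    (lift d h).coeff d = h.eval 1 := by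
  rw [lift, finsetSum_coeff, eval_eq_sum_range' (n := d + 1) (by omega)]
  refine Finset.sum_congr rfl fun i hi => ?_
  have := Finset.mem_range.1 hi
  have hm : (X ^ i * (X + 1) ^ (d - i) : ℝ[X]).Monic :=
    (monic_X_pow i).mul ((by simpa using monic_X_add_C (1 : ℝ) : (X + 1 : ℝ[X]).Monic).pow _)
  have hdeg : (X ^ i * (X + 1) ^ (d - i) : ℝ[X]).natDegree = d := by
    rw [(monic_X_pow i).natDegree_mul
      ((by simpa using monic_X_add_C (1 : ℝ) : (X + 1 : ℝ[X]).Monic).pow _)]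
    have : (X + 1 : ℝ[X]).natDegree = 1 := by simpa using natDegree_X_add_C (1 : ℝ)
    rw [natDegree_X_pow, natDegree_pow, this]
    omega
  rw [coeff_C_mul]
  have h1 := hm.coeff_natDegree
  rw [hdeg] at h1
  simp [h1]

theorem IsNonnegLift.coeff_pos {d : ℕ} {f : ℝ[X]} (hf : IsNonnegLift d f) (h0 : f ≠ 0) :
    0 < f.coeff d := by
  obtain ⟨h, h1, h2, rfl⟩ := hf
  have hh : h ≠ 0 := by rintro rfl; simp at h0
  rw [coeff_lift d h1, eval_eq_sum_range]
  refine Finset.sum_pos' (fun i _ => by simpa using h2 i) ⟨h.natDegree, by simp, ?_⟩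
  simpa using lt_of_le_of_ne (h2 h.natDegree) (Ne.symm (by simpa using hh))

theorem IsNonnegLift.natDegree_eq {d : ℕ} {f : ℝ[X]} (hf : IsNonnegLift d f) (h0 : f ≠ 0) :
    f.natDegree = d :=
  le_antisymm hf.natDegree_le (le_natDegree_of_ne_zero (hf.coeff_pos h0).ne')

theorem IsNonnegLift.leadingCoeff_pos {d : ℕ} {f : ℝ[X]} (hf : IsNonnegLift d f) (h0 : f ≠ 0) :
    0 < f.leadingCoeff := by
  rw [leadingCoeff, hf.natDegree_eq h0]
  exact hf.coeff_pos h0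

end Cone

/-! ### Newton expansions, generating functions and the product `p q`. -/

section GeneratingFunction

/-- The operator that corresponds to `p(x) ↦ p(x + 1)` in the basis of binomial coefficients. -/
noncomputable def newtonShift (f : ℝ[X]) : ℝ[X] := f + divX f

/-- The value at `j` of `∑ k, f_k * (x choose k)`. -/
noncomputable def newtonEval (j : ℕ) (f : ℝ[X]) : ℝ := (newtonShift^[j] f).coeff 0

/-- The generating function of the values at natural numbers of `∑ k, f_k * (x choose k)`. -/
noncomputable def newtonSeries (f : ℝ[X]) : PowerSeries ℝ :=
  PowerSeries.mk fun j => newtonEval j f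

theorem newtonShift_add (f g : ℝ[X]) :
    newtonShift (f + g) = newtonShift f + newtonShift g := by
  simp only [newtonShift, divX_add]
  ring

theorem newtonShift_C_mul (c : ℝ) (f : ℝ[X]) :
    newtonShift (C c * f) = C c * newtonShift f := by
  simp only [newtonShift, divX_C_mul]
  ring

theorem newtonShift_C (c : ℝ) : newtonShift (C c) = C c := by simp [newtonShift]

theorem newtonShift_X_mul (f : ℝ[X]) : newtonShift (X * f) = (X + 1) * f := by
  have : divX (X * f) = f := by
    ext n
    simp [coeff_divX, coeff_X_mul]
  rw [newtonShift, this]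
  ring

/-- After splitting off constant terms, `newtonShift` only replaces an outer factor `X` by `X + 1`,
and the diamond recursions for these two factors have the same bracket. -/
theorem newtonShift_diamond (f g : ℝ[X]) :
    newtonShift (diamond f g) = diamond (newtonShift f) (newtonShift g) := by
  obtain ⟨φ, c, rfl⟩ : ∃ φ c, f = X * φ + C c :=
    ⟨divX f, f.coeff 0, by rw [mul_comm, divX_mul_X_add]⟩
  obtain ⟨ψ, e, rfl⟩ : ∃ φ c, g = X * φ + C c :=
    ⟨divX g, g.coeff 0, by rw [mul_comm, divX_mul_X_add]⟩
  simp only [diamond_add_left, diamond_add_right, diamond_C_left, diamond_C_right,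
    newtonShift_add, newtonShift_X_mul, newtonShift_C, diamond_X_mul_X_mul,
    diamond_X_add_one_mul, newtonShift_C_mul]

theorem newtonEval_add (j : ℕ) (f g : ℝ[X]) :
    newtonEval j (f + g) = newtonEval j f + newtonEval j g := by
  induction j generalizing f g with
  | zero => simp [newtonEval]
  | succ j ih =>
    simp only [newtonEval, Function.iterate_succ_apply, newtonShift_add] at ih ⊢
    exact ih _ _

theorem newtonEval_C_mul (j : ℕ) (c : ℝ) (f : ℝ[X]) :
    newtonEval j (C c * f) = c * newtonEval j f := by
  induction j generalizing f with
  | zero => simp [newtonEval]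
  | succ j ih =>
    simp only [newtonEval, Function.iterate_succ_apply, newtonShift_C_mul] at ih ⊢
    exact ih _

theorem newtonEval_diamond (j : ℕ) (f g : ℝ[X]) :
    newtonEval j (diamond f g) = newtonEval j f * newtonEval j g := by
  induction j generalizing f g with
  | zero => simp [newtonEval, coeff_zero_diamond]
  | succ j ih =>
    simp only [newtonEval, Function.iterate_succ_apply, newtonShift_diamond] at ih ⊢
    exact ih _ _

theorem newtonSeries_add (f g : ℝ[X]) :
    newtonSeries (f + g) = newtonSeries f + newtonSeries g := by
  ext j
  simp [newtonSeries, newtonEval_add]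

theorem newtonSeries_C_mul (c : ℝ) (f : ℝ[X]) :
    newtonSeries (C c * f) = PowerSeries.C c * newtonSeries f := by
  ext j
  simp [newtonSeries, newtonEval_C_mul]

theorem newtonSeries_X_mul (f : ℝ[X]) :
    newtonSeries (X * f) = PowerSeries.X * newtonSeries ((X + 1) * f) := by
  ext j
  rcases j with _ | j
  · simp [newtonSeries, newtonEval]
  · simp [newtonSeries, newtonEval, newtonShift_X_mul, PowerSeries.coeff_succ_X_mul]

theorem one_sub_X_mul_newtonSeries (f : ℝ[X]) :
    (1 - PowerSeries.X) * newtonSeries ((X + 1) * f) = newtonSeries f := by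
  have h1 := newtonSeries_X_mul f
  have h2 : newtonSeries ((X + 1) * f) = newtonSeries (X * f) + newtonSeries f := by
    rw [← newtonSeries_add]
    ring_nf
  linear_combination h2 + h1

/-- On generating functions, multiplication by `x + 1` is division by `1 - x`, and multiplication by
`x` is multiplication by `x / (1 - x)`. -/
theorem one_sub_X_pow_mul_newtonSeries (i j : ℕ) :
    (1 - PowerSeries.X) ^ (i + j + 1) * newtonSeries (X ^ i * (X + 1) ^ j) =
      PowerSeries.X ^ i := by
  induction j with
  | zero =>
    induction i with
    | zero =>
      have h1 : newtonSeries 1 = PowerSeries.mk 1 := by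
        ext j
        simp only [newtonSeries, PowerSeries.coeff_mk, newtonEval, Pi.one_apply]
        induction j with
        | zero => simp
        | succ j ih => rw [Function.iterate_succ_apply, ← C_1, newtonShift_C, C_1, ih]
      simp only [pow_zero, mul_one, zero_add, pow_one, add_zero]
      rw [h1, mul_comm]
      exact PowerSeries.mk_one_mul_one_sub_eq_one ℝ
    | succ i ih =>
      rw [pow_succ' X, mul_assoc, newtonSeries_X_mul]
      calc _ = PowerSeries.X * ((1 - PowerSeries.X) ^ (i + 0 + 1) * ((1 - PowerSeries.X) *
            newtonSeries ((X + 1) * (X ^ i * (X + 1) ^ 0)))) := by ring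
        _ = _ := by rw [one_sub_X_mul_newtonSeries, ih, pow_succ']
  | succ j ih =>
    calc _ = (1 - PowerSeries.X) ^ (i + j + 1) * ((1 - PowerSeries.X : PowerSeries ℝ) *
            newtonSeries ((X + 1) * (X ^ i * (X + 1) ^ j))) := by
              rw [show (X + 1) * (X ^ i * (X + 1) ^ j) = X ^ i * (X + 1 : ℝ[X]) ^ (j + 1) by ring]
              ring
      _ = _ := by rw [one_sub_X_mul_newtonSeries, ih]

theorem one_sub_X_pow_mul_newtonSeries_lift {d : ℕ} {h : ℝ[X]} (hd : h.natDegree ≤ d) :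
    (1 - PowerSeries.X) ^ (d + 1) * newtonSeries (lift d h) = (h : PowerSeries ℝ) := by
  have hs : ∀ s : Finset ℕ, (∀ i ∈ s, i ≤ d) → (1 - PowerSeries.X) ^ (d + 1) *
      newtonSeries (∑ i ∈ s, C (h.coeff i) * (X ^ i * (X + 1) ^ (d - i))) =
        ((∑ i ∈ s, C (h.coeff i) * X ^ i : ℝ[X]) : PowerSeries ℝ) := by
    intro s
    induction s using Finset.cons_induction with
    | empty =>
      intro _
      have : newtonSeries 0 = 0 := by simpa using newtonSeries_C_mul 0 0
      simp [this]
    | cons a s ha ih =>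
      intro h'
      have had : a ≤ d := h' a (by simp)
      rw [Finset.sum_cons, newtonSeries_add, mul_add, ih fun i hi => h' i (by simp [hi]),
        Finset.sum_cons, coe_add, newtonSeries_C_mul, mul_left_comm]
      have := one_sub_X_pow_mul_newtonSeries a (d - a)
      rw [show a + (d - a) = d by omega] at this
      rw [this]
      simp
  have := hs (Finset.range (d + 1)) fun i hi => by have := Finset.mem_range.1 hi; omega
  rw [lift, this, ← as_sum_range_C_mul_X_pow' (p := h) (by omega)]

theorem lift_injective {d : ℕ} {h k : ℝ[X]} (hh : h.natDegree ≤ d) (hk : k.natDegree ≤ d)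
    (e : lift d h = lift d k) : h = k := by
  apply Polynomial.coe_injective ℝ
  rw [← one_sub_X_pow_mul_newtonSeries_lift hh, ← one_sub_X_pow_mul_newtonSeries_lift hk, e]

theorem natDegree_numeratorPoly_le (p : ℝ[X]) : (numeratorPoly p).natDegree ≤ p.natDegree :=
  Nat.lt_succ_iff.1 (PowerSeries.natDegree_trunc_lt _ _)

theorem one_sub_X_pow_ne_zero (n : ℕ) : (1 - PowerSeries.X : PowerSeries ℝ) ^ n ≠ 0 := by
  refine pow_ne_zero _ fun h => ?_
  have := congrArg (PowerSeries.coeff 0) h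
  simp at this

/-- The lift of the numerator therefore lists the coefficients of `p` in the basis of binomial
coefficients. -/
theorem newtonEval_lift_numeratorPoly (p : ℝ[X]) (j : ℕ) :
    newtonEval j (lift p.natDegree (numeratorPoly p)) = p.eval (j : ℝ) := by
  have h := one_sub_X_pow_mul_newtonSeries_lift (natDegree_numeratorPoly_le p)
  rw [coe_numeratorPoly] at h
  have := congrArg (PowerSeries.coeff j) (mul_left_cancel₀ (one_sub_X_pow_ne_zero _) h)
  simpa [newtonSeries] using this

theorem lift_numeratorPoly_ne_zero {p : ℝ[X]} (hp : p ≠ 0) :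
    lift p.natDegree (numeratorPoly p) ≠ 0 := by
  intro h
  refine hp (Polynomial.eq_zero_of_infinite_isRoot p ?_)
  refine (Set.infinite_range_of_injective (Nat.cast_injective (R := ℝ))).mono ?_
  rintro _ ⟨j, rfl⟩
  have := newtonEval_lift_numeratorPoly p j
  rw [h] at this
  have h0 : newtonEval j 0 = 0 := by simpa using newtonEval_C_mul j 0 0
  rw [Set.mem_ofPred_eq, IsRoot, ← this, h0]

theorem numeratorPoly_mul_eq {p q H : ℝ[X]} (hp : p ≠ 0) (hq : q ≠ 0)
    (hH : H.natDegree ≤ p.natDegree + q.natDegree)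
    (h : lift (p.natDegree + q.natDegree) H = diamond
      (lift p.natDegree (numeratorPoly p)) (lift q.natDegree (numeratorPoly q))) :
    numeratorPoly (p * q) = H := by
  apply Polynomial.coe_injective ℝ
  rw [coe_numeratorPoly, natDegree_mul hp hq, ← one_sub_X_pow_mul_newtonSeries_lift hH, h]
  congr 1
  ext j
  simp [newtonSeries, newtonEval_diamond, newtonEval_lift_numeratorPoly]

end GeneratingFunction

/-! ### Stable polynomials and the diamond product. -/

section Stability

/-- A complex polynomial without zeros in the open upper half-plane. -/
def IsStable (f : ℂ[X]) : Prop := ∀ z : ℂ, 0 < z.im → f.eval z ≠ 0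

theorem inv_im_neg {z : ℂ} (h : 0 < z.im) : (z⁻¹).im < 0 := by
  rw [Complex.inv_im]
  have : 0 < Complex.normSq z := Complex.normSq_pos.2 (by rintro rfl; simp at h)
  exact div_neg_of_neg_of_pos (by linarith) this

theorem multiset_sum_im_neg {s : Multiset ℂ} (hs : s ≠ 0) (h : ∀ z ∈ s, z.im < 0) :
    s.sum.im < 0 := by
  induction s using Multiset.induction_on with
  | empty => exact absurd rfl hs
  | cons a s ih =>
    rw [Multiset.sum_cons, Complex.add_im]
    have ha := h a (by simp)
    rcases eq_or_ne s 0 with rfl | h0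
    · simpa using ha
    · have := ih h0 fun z hz => h z (by simp [hz])
      linarith

/-- `f' / f` is the sum of `1 / (z - y)` over the zeros `y`, which lie in the closed lower
half-plane, so its imaginary part is negative at `z`. The condition `ζ ≠ 0` covers constant `f`,
where the sum is empty. -/
theorem IsStable.derivative_sub {f : ℂ[X]} (hf : IsStable f) {ζ : ℂ} (h : 0 ≤ ζ.im)
    (h0 : ζ ≠ 0) : IsStable (derivative f - C ζ * f) := by
  intro z hz he
  have hfz := hf z hz
  have e := (IsAlgClosed.splits f).eval_derivative_div_eval_of_ne_zero hfz
  have : eval z (derivative f) / eval z f = ζ := by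
    rw [div_eq_iff hfz]
    simpa [sub_eq_zero] using he
  rw [this] at e
  rcases eq_or_ne f.roots 0 with hr | hr
  · rw [hr] at e
    exact h0 (by simpa using e)
  · have : (f.roots.map fun y => 1 / (z - y)).sum.im < 0 := by
      refine multiset_sum_im_neg (by simpa using hr) fun w hw => ?_
      obtain ⟨y, hy, rfl⟩ := Multiset.mem_map.1 hw
      rw [one_div]
      refine inv_im_neg ?_
      have : y.im ≤ 0 := by
        by_contra hc
        exact hf y (not_le.1 hc) (isRoot_of_mem_roots hy)
      rw [Complex.sub_im]
      linarith
    rw [← e] at this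
    linarith

theorem IsStable.aeval_derivative {f : ℂ[X]} (hf : IsStable f) {r : ℂ[X]} (h0 : r.eval 0 ≠ 0)
    (hr : ∀ z : ℂ, z.im < 0 → r.eval z ≠ 0) :
    IsStable (aeval (derivative : ℂ[X] →ₗ[ℂ] ℂ[X]) r f) := by
  have key : ∀ s : Multiset ℂ, (∀ ζ ∈ s, 0 ≤ ζ.im ∧ ζ ≠ 0) →
      IsStable (aeval (derivative : ℂ[X] →ₗ[ℂ] ℂ[X]) (s.map fun ζ => X - C ζ).prod f) := by
    intro s
    induction s using Multiset.induction_on with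
    | empty => intro _; simpa using hf
    | cons a s ih =>
      intro h
      have := (ih fun ζ hζ => h ζ (by simp [hζ])).derivative_sub (h a (by simp)).1
        (h a (by simp)).2
      rw [Multiset.map_cons, Multiset.prod_cons, map_mul, Module.End.mul_apply]
      simpa [Module.algebraMap_end_apply, smul_eq_C_mul] using this
  have hr0 : r ≠ 0 := by rintro rfl; simp at h0
  rw [(IsAlgClosed.splits r).eq_prod_roots, map_mul, Module.End.mul_apply, aeval_C,
    Module.algebraMap_end_apply]
  intro z hz
  rw [eval_smul, smul_eq_mul]
  refine mul_ne_zero (by simpa using hr0) (key _ (fun ζ hζ => ⟨?_, ?_⟩) z hz)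
  · by_contra hc
    exact hr ζ (not_le.1 hc) (isRoot_of_mem_roots hζ)
  · rintro rfl
    exact h0 (isRoot_of_mem_roots hζ)

/-- The polynomials obtained from `q` by applying `∏_{j ≤ m} (1 + (x / j) d/dx)`. -/
noncomputable def laguerreSeq (q : ℂ[X]) : ℕ → ℂ[X]
  | 0 => q
  | m + 1 => laguerreSeq q m + C ((m + 1 : ℂ)⁻¹) * (X * derivative (laguerreSeq q m))

theorem laguerreSeq_coeff (q : ℂ[X]) (m k : ℕ) :
    (laguerreSeq q m).coeff k = ((k + m).choose m : ℂ) * q.coeff k := by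
  induction m with
  | zero => simp [laguerreSeq]
  | succ m ih =>
    have h1 : (X * derivative (laguerreSeq q m)).coeff k = k * (laguerreSeq q m).coeff k := by
      rcases k with _ | k
      · simp
      · rw [coeff_X_mul, coeff_derivative]
        push_cast
        ring
    have h2 : (m + 1 : ℂ) ≠ 0 := by exact_mod_cast Nat.succ_ne_zero m
    have h3 : ((k + m + 1).choose (m + 1) : ℂ) * (m + 1) = (k + m + 1) * (k + m).choose m := by
      have := Nat.add_one_mul_choose_eq (k + m) m
      exact_mod_cast this.symm
    rw [laguerreSeq, coeff_add, coeff_C_mul, h1, ih, ← add_assoc]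
    field_simp
    linear_combination (-q.coeff k) * h3

/-- A zero `z` of the next polynomial forces `Q' / Q = -(m + 1) / z`, with imaginary part at most
`0`; but all zeros of `Q` lie above `z`, so `∑ 1 / (z - y)` has positive imaginary part. -/
theorem laguerreSeq_eval_ne_zero {q : ℂ[X]} (hq : ∀ z : ℂ, z.im ≤ 0 → q.eval z ≠ 0) (m : ℕ) :
    ∀ z : ℂ, z.im ≤ 0 → (laguerreSeq q m).eval z ≠ 0 := by
  induction m with
  | zero => exact hq
  | succ m ih =>
    intro z hz he
    set Q := laguerreSeq q m
    have hQz := ih z hz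
    have hm : (m + 1 : ℂ) ≠ 0 := by exact_mod_cast Nat.succ_ne_zero m
    have he' : eval z Q + (m + 1 : ℂ)⁻¹ * (z * eval z (derivative Q)) = 0 := by
      simpa [laguerreSeq] using he
    have hz0 : z ≠ 0 := by
      rintro rfl
      exact hQz (by simpa using he')
    have e := (IsAlgClosed.splits Q).eval_derivative_div_eval_of_ne_zero hQz
    have h2 : eval z (derivative Q) / eval z Q = -((m + 1 : ℝ) * z⁻¹) := by
      rw [div_eq_iff hQz]
      push_cast
      field_simp at he' ⊢
      linear_combination he'
    have h3 : (-((m + 1 : ℝ) * z⁻¹)).im ≤ 0 := by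
      rw [Complex.neg_im, Complex.im_ofReal_mul, Complex.inv_im, neg_nonpos]
      have := Complex.normSq_nonneg z
      have : 0 ≤ -z.im := by linarith
      positivity
    rw [h2] at e
    rcases eq_or_ne Q.roots 0 with hr | hr
    · rw [hr] at e
      simp [hz0] at e
      exact hm e
    · have h4 : 0 < (Q.roots.map fun y => 1 / (z - y)).sum.im := by
        have := multiset_sum_im_neg (s := Q.roots.map fun y => 1 / (y - z)) (by simpa using hr)
          fun w hw => by
            obtain ⟨y, hy, rfl⟩ := Multiset.mem_map.1 hw
            rw [one_div]
            refine inv_im_neg ?_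
            have : 0 < y.im := by
              by_contra hc
              exact ih y (not_lt.1 hc) (isRoot_of_mem_roots hy)
            rw [Complex.sub_im]
            linarith
        have e2 : (Q.roots.map fun y => 1 / (z - y)) =
            Q.roots.map fun y => -(1 / (y - z)) := by
          refine Multiset.map_congr rfl fun y _ => ?_
          rw [← neg_sub y z, div_neg]
        rw [e2, Multiset.sum_map_neg, Complex.neg_im]
        linarith
      rw [← e] at h4
      linarith

/-- Each zero lies above the real axis, hence at distance at least `-Im z` from `z`. This
quantitative bound plays the role of Hurwitz's theorem in the limit of `laguerreSeq`. -/
theorem norm_eval_ge {P : ℂ[X]} (hP : ∀ z : ℂ, z.im ≤ 0 → P.eval z ≠ 0) {z : ℂ}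
    (hz : z.im < 0) : ‖P.leadingCoeff‖ * (-z.im) ^ P.natDegree ≤ ‖P.eval z‖ := by
  have hs := IsAlgClosed.splits P
  have key : ∀ s : Multiset ℂ, (∀ ζ ∈ s, 0 < ζ.im) →
      (-z.im) ^ s.card ≤ ‖(s.map fun ζ => z - ζ).prod‖ := by
    intro s
    induction s using Multiset.induction_on with
    | empty => simp
    | cons a s ih =>
      intro h
      rw [Multiset.map_cons, Multiset.prod_cons, norm_mul, Multiset.card_cons, pow_succ']
      have h1 := ih fun ζ hζ => h ζ (by simp [hζ])
      have h2 : -z.im ≤ ‖z - a‖ := by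
        have := Complex.abs_im_le_norm (z - a)
        have ha := h a (by simp)
        rw [Complex.sub_im, abs_of_nonpos (by linarith)] at this
        linarith
      have h3 : 0 ≤ -z.im := by linarith
      gcongr
  rw [hs.eval_eq_prod_roots, norm_mul, hs.natDegree_eq_card_roots]
  gcongr
  refine key _ fun ζ hζ => ?_
  by_contra hc
  exact hP ζ (not_lt.1 hc) (isRoot_of_mem_roots hζ)

theorem tendsto_choose_div_pow (k : ℕ) :
    Filter.Tendsto (fun m : ℕ => ((k + m).choose m : ℝ) / (m : ℝ) ^ k) Filter.atTop
      (nhds (k.factorial : ℝ)⁻¹) := by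
  induction k with
  | zero => simp
  | succ k ih =>
    have h1 : Filter.Tendsto (fun m : ℕ => (((k : ℝ) + 1) / m + 1) / (k + 1)) Filter.atTop
        (nhds ((0 + 1) / (k + 1))) :=
      ((tendsto_const_div_atTop_nhds_zero_nat _).add_const 1).div_const _
    have h2 := ih.mul h1
    have h3 : (k.factorial : ℝ)⁻¹ * ((0 + 1) / (k + 1)) = ((k + 1).factorial : ℝ)⁻¹ := by
      rw [Nat.factorial_succ]
      push_cast
      field_simp
      ring
    rw [h3] at h2
    refine h2.congr' ?_
    filter_upwards [Filter.eventually_gt_atTop 0] with m hm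
    have hm' : (m : ℝ) ≠ 0 := by positivity
    have h4 : ((k + 1 + m).choose m : ℝ) * (k + 1) = (k + m + 1) * (k + m).choose m := by
      have h5 := Nat.add_one_mul_choose_eq (k + m) k
      have h6 : (k + 1 + m).choose m = (k + m + 1).choose (k + 1) := by
        rw [show k + 1 + m = k + m + 1 by ring]
        exact (Nat.choose_symm_of_eq_add (by ring))
      have h7 : (k + m).choose m = (k + m).choose k := Nat.choose_symm_of_eq_add (by ring)
      rw [h6, h7]
      exact_mod_cast h5.symm
    have h8 : ((k + 1 + m).choose m : ℝ) = (k + m + 1) * (k + m).choose m / (k + 1) := by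
      rw [← h4]
      field_simp
    rw [h8, pow_succ]
    field_simp
    ring

/-- Laguerre: dividing the `k`-th coefficient by `k!` keeps the zeros in the upper half-plane. -/
theorem sum_coeff_div_factorial_ne_zero {q : ℂ[X]} (hq : ∀ z : ℂ, z.im ≤ 0 → q.eval z ≠ 0)
    {z : ℂ} (hz : z.im < 0) :
    ∑ k ∈ Finset.range (q.natDegree + 1), q.coeff k / (k.factorial : ℂ) * z ^ k ≠ 0 := by
  set n := q.natDegree with hn
  have hq0 : q ≠ 0 := by
    rintro rfl
    exact hq z hz.le (by simp)
  have hle : ∀ m, (laguerreSeq q m).natDegree ≤ n := fun m =>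
    natDegree_le_iff_coeff_eq_zero.2 fun k hk => by
      rw [laguerreSeq_coeff, coeff_eq_zero_of_natDegree_lt hk, mul_zero]
  have hdeg : ∀ m, (laguerreSeq q m).natDegree = n := fun m =>
    le_antisymm (hle m) (le_natDegree_of_ne_zero (by
      rw [laguerreSeq_coeff]
      refine mul_ne_zero ?_ (by simpa [hn] using hq0)
      exact_mod_cast (Nat.choose_pos (by omega)).ne'))
  -- At `z / m` the `k`-th coefficient acquires the factor `(k + m choose m) / m^k`, which tends to
  -- `1 / k!`.
  have h1 : Filter.Tendsto (fun m : ℕ => (laguerreSeq q m).eval (z / m)) Filter.atTop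
      (nhds (∑ k ∈ Finset.range (n + 1), q.coeff k / (k.factorial : ℂ) * z ^ k)) := by
    have : ∀ m : ℕ, (laguerreSeq q m).eval (z / m) = ∑ k ∈ Finset.range (n + 1),
        ((((k + m).choose m : ℝ) / (m : ℝ) ^ k : ℝ) : ℂ) * (q.coeff k * z ^ k) := by
      intro m
      rw [eval_eq_sum_range' (n := n + 1) (by have := hle m; omega)]
      refine Finset.sum_congr rfl fun k _ => ?_
      rw [laguerreSeq_coeff, div_pow]
      push_cast
      ring
    simp only [this]
    refine tendsto_finsetSum _ fun k _ => ?_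
    have := ((Complex.continuous_ofReal.tendsto _).comp (tendsto_choose_div_pow k)).mul_const
      (q.coeff k * z ^ k)
    convert this using 2
    · simp
    · push_cast
      ring
  -- The lower bounds of `norm_eval_ge` at `z / m` have a positive limit: the factor `m^n` is
  -- absorbed by the growth of the leading coefficient.
  have h2 : Filter.Tendsto (fun m : ℕ => ((n + m).choose m : ℝ) / (m : ℝ) ^ n *
      (‖q.leadingCoeff‖ * (-z.im) ^ n)) Filter.atTop
      (nhds ((n.factorial : ℝ)⁻¹ * (‖q.leadingCoeff‖ * (-z.im) ^ n))) :=
    (tendsto_choose_div_pow n).mul_const _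
  have h3 := le_of_tendsto_of_tendsto h2 h1.norm (by
    filter_upwards [Filter.eventually_gt_atTop 0] with m hm
    have hm' : (0 : ℝ) < m := by positivity
    have him : (z / m).im = z.im / m := by
      simp
    have := norm_eval_ge (laguerreSeq_eval_ne_zero hq m) (z := z / m)
      (by rw [him]; exact div_neg_of_neg_of_pos hz hm')
    rw [hdeg, leadingCoeff, hdeg, laguerreSeq_coeff, him] at this
    refine le_trans (le_of_eq ?_) this
    rw [norm_mul, Complex.norm_natCast, ← neg_div, div_pow, leadingCoeff, ← hn]
    ring)
  have h4 : 0 < (n.factorial : ℝ)⁻¹ * (‖q.leadingCoeff‖ * (-z.im) ^ n) := by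
    have : 0 < ‖q.leadingCoeff‖ := by simpa using hq0
    have : 0 < -z.im := by linarith
    positivity
  intro h
  rw [h, norm_zero] at h3
  linarith

/-- Solving gives `z = (-s) (-1 / x) + (1 + s) (-1 / (x + 1))`, a convex combination of points of
the upper half-plane precisely because `s ∈ [-1, 0]`. The proof clears the denominator `|x (x +
1)|^2`. -/
theorem im_pos_of_mul_eq {x z : ℂ} {s : ℝ} (hx : 0 < x.im) (h1 : -1 ≤ s) (h2 : s ≤ 0)
    (h : x * (x + 1) * z + x = s) : 0 < z.im := by
  have hre := congrArg Complex.re h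
  have him := congrArg Complex.im h
  simp at hre him
  by_contra hc
  set u := x.re
  set v := x.im
  have key : z.im * ((u * (u + 1) - v * v) ^ 2 + (u * v + v * (u + 1)) ^ 2) =
      v * ((u - s) ^ 2 + v ^ 2 - s * (s + 1)) := by
    linear_combination (-(u * v + v * (u + 1))) * hre + (u * (u + 1) - v * v) * him
  have h3 : 0 < v * ((u - s) ^ 2 + v ^ 2 - s * (s + 1)) := by
    apply mul_pos hx
    have : 0 < v ^ 2 := by positivity
    nlinarith [sq_nonneg (u - s), mul_nonneg (neg_nonneg.2 h2) (by linarith : 0 ≤ s + 1)]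
  have h4 : z.im * ((u * (u + 1) - v * v) ^ 2 + (u * v + v * (u + 1)) ^ 2) ≤ 0 :=
    mul_nonpos_of_nonpos_of_nonneg (not_lt.1 hc) (by positivity)
  linarith

/-- The zeros of `g` lie in the interval `[-1, 0]`. -/
def RootsInUnit (g : ℂ[X]) : Prop :=
  g ≠ 0 ∧ ∀ z : ℂ, g.eval z = 0 → ∃ s : ℝ, z = s ∧ -1 ≤ s ∧ s ≤ 0

theorem IsStable.diamond {f g : ℂ[X]} (hf : IsStable f) (hg : RootsInUnit g) :
    IsStable (diamond g f) := by
  intro x hx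
  -- With `x` frozen, `q(z) = g(x + w z)` has all zeros in the open upper half-plane. Laguerre's
  -- theorem divides its coefficients by `k!` to give `r`, and `r(d/dx) f` evaluated at `x` is the
  -- diamond product.
  set w : ℂ := x * (x + 1) with hw
  set q : ℂ[X] := (taylor x g).comp (C w * X) with hqdef
  have hw0 : w ≠ 0 := by
    refine mul_ne_zero ?_ ?_ <;> intro h <;> have := congrArg Complex.im h <;> simp at this <;>
      linarith
  have hqc : ∀ k, q.coeff k = (hasseDeriv k g).eval x * w ^ k := fun k => by
    rw [hqdef, comp_C_mul_X_coeff, taylor_coeff]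
  have hq : ∀ z : ℂ, z.im ≤ 0 → q.eval z ≠ 0 := by
    intro z hz h
    rw [hqdef, eval_comp, taylor_eval] at h
    obtain ⟨s, h1, h2, h3⟩ := hg.2 _ h
    have := im_pos_of_mul_eq (z := z) hx h2 h3 (by rw [← h1]; simp [hw])
    linarith
  have hqd : q.natDegree = g.natDegree := by
    rw [hqdef, natDegree_comp, natDegree_taylor, natDegree_C_mul_X _ hw0, mul_one]
  set r : ℂ[X] := ∑ k ∈ Finset.range (g.natDegree + 1),
    C (q.coeff k / (k.factorial : ℂ)) * X ^ k with hr
  have hre : ∀ z, r.eval z = ∑ k ∈ Finset.range (q.natDegree + 1),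
      q.coeff k / (k.factorial : ℂ) * z ^ k := fun z => by
    rw [hr, hqd, eval_finsetSum]
    simp
  have h0 : r.eval 0 ≠ 0 := by
    have := hq 0 (by simp)
    rw [hre, Finset.sum_range_succ']
    simpa [coeff_zero_eq_eval_zero] using this
  have := hf.aeval_derivative h0 (fun z hz => by
    rw [hre]; exact sum_coeff_div_factorial_ne_zero hq hz) x hx
  convert this using 1
  rw [hr, map_sum, LinearMap.sum_apply, eval_finsetSum, _root_.diamond, eval_finsetSum]
  refine Finset.sum_congr rfl fun k _ => ?_
  have hk : (k.factorial : ℂ) ≠ 0 := by exact_mod_cast k.factorial_ne_zero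
  rw [map_mul, aeval_C, map_pow, aeval_X, Module.End.mul_apply, Module.algebraMap_end_apply,
    eval_smul, Module.End.pow_apply, ← factorial_smul_hasseDeriv, hqc,
    LinearMap.smul_apply]
  simp only [eval_mul, eval_pow, eval_X, eval_add, eval_one, smul_eq_mul, nsmul_eq_mul,
    eval_natCast, ← hw]
  field_simp

end Stability

/-! ### Interleaving lists of zeros and the cone they generate. -/

section Interleaving

/-- The lists `s₁, s₂, …` and `t₁, t₂, …` interleave: `s₁ ≥ t₁ ≥ s₂ ≥ t₂ ≥ ⋯`. -/
inductive Interleaved : List ℝ → List ℝ → Prop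
  | nil : Interleaved [] []
  | cons {s : ℝ} {ss ts : List ℝ} (h : ∀ t ∈ ts, t ≤ s) (h' : Interleaved ts ss) :
      Interleaved (s :: ss) ts

theorem interleaved_of_getElem (n : ℕ) : ∀ {s t : List ℝ}, s.length + t.length = n →
    s.Pairwise (· ≥ ·) → t.Pairwise (· ≥ ·) →
    t.length ≤ s.length → s.length ≤ t.length + 1 →
    (∀ (i : ℕ) (hs : i < s.length) (ht : i < t.length), t[i] ≤ s[i]) →
    (∀ (i : ℕ) (hs : i + 1 < s.length) (ht : i < t.length), s[i + 1] ≤ t[i]) →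
    Interleaved s t := by
  induction n with
  | zero =>
    intro s t hn _ _ _ _ _ _
    obtain rfl : s = [] := List.length_eq_zero_iff.1 (by omega)
    obtain rfl : t = [] := List.length_eq_zero_iff.1 (by omega)
    exact .nil
  | succ n ih =>
    intro s t hn hs ht h1 h2 h3 h4
    rcases s with _ | ⟨a, ss⟩
    · simp only [List.length_nil, Nat.le_zero] at h1
      simp [h1] at hn
    · simp only [List.length_cons] at hn h1 h2
      refine .cons (fun x hx => ?_) (ih (by omega) ht hs.tail (by omega) (by omega) ?_ ?_)
      · obtain ⟨i, hi, rfl⟩ := List.getElem_of_mem hx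
        refine (h3 i (by simp; omega) hi).trans ?_
        rcases i with _ | i
        · exact le_rfl
        · exact (List.pairwise_cons.1 hs).1 _ (List.getElem_mem _)
      · intro i h5 h6
        exact h4 i (by simp; omega) h5
      · intro i h5 h6
        exact h3 (i + 1) (by simp; omega) h5

/-- The monic polynomial whose zeros are listed in `l`. -/
noncomputable def rootsProd (l : List ℝ) : ℝ[X] := (l.map fun s => X - C s).prod

@[simp] theorem rootsProd_nil : rootsProd [] = 1 := rfl

@[simp] theorem rootsProd_cons (s : ℝ) (l : List ℝ) :
    rootsProd (s :: l) = (X - C s) * rootsProd l := by simp [rootsProd]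

/-- A convex cone that contains `f` and all `(x + 1) f / (x - s)`, for zeros `s` of `f`, contains
every polynomial of the same degree that interlaces `f` and has its zeros in `[-1, ∞)`. -/
theorem Interleaved.cone_induction {s t : List ℝ} (h : Interleaved s t)
    (hl : s.length = t.length) (hs : ∀ x ∈ s, -1 ≤ x) (ht : ∀ x ∈ t, -1 ≤ x)
    (P : ℝ[X] → Prop) (add : ∀ f g, P f → P g → P (f + g))
    (smul : ∀ (c : ℝ) f, 0 ≤ c → P f → P (C c * f)) (base : P (rootsProd s))
    (step : ∀ x ∈ s, ∀ ψ, rootsProd s = (X - C x) * ψ → P ((X + 1) * ψ)) :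
    P (rootsProd t) := by
  induction s generalizing t P with
  | nil =>
    obtain rfl : t = [] := List.length_eq_zero_iff.1 (by simpa using hl.symm)
    exact base
  | cons s₁ ss ih =>
    rcases t with _ | ⟨t₁, ts⟩
    · simp at hl
    obtain ⟨h1, h2⟩ : (∀ t ∈ t₁ :: ts, t ≤ s₁) ∧ Interleaved (t₁ :: ts) ss := by
      cases h with | cons h h' => exact ⟨h, h'⟩
    obtain ⟨h3, h4⟩ : (∀ t ∈ ss, t ≤ t₁) ∧ Interleaved ss ts := by
      cases h2 with | cons h h' => exact ⟨h, h'⟩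
    have hts : t₁ ≤ s₁ := h1 _ (by simp)
    have ht₁ : -1 ≤ t₁ := ht _ (by simp)
    -- For `x ≤ t₁ ≤ s₁` the factor `X - t₁` is a convex combination of `X - s₁` and `X - x`.
    have between : ∀ (x : ℝ) (φ : ℝ[X]), x ≤ t₁ → P ((X - C s₁) * φ) → P ((X - C x) * φ) →
        P ((X - C t₁) * φ) := by
      intro x φ hx hP hP'
      rcases eq_or_lt_of_le (hx.trans hts) with he | hlt
      · rwa [le_antisymm hts (he ▸ hx)]
      · have hne : s₁ - x ≠ 0 := by linarith
        have hpos : 0 < s₁ - x := by linarith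
        have e : (X - C t₁) * φ = C ((t₁ - x) / (s₁ - x)) * ((X - C s₁) * φ) +
            C ((s₁ - t₁) / (s₁ - x)) * ((X - C x) * φ) := by
          have e1 : (t₁ - x) / (s₁ - x) + (s₁ - t₁) / (s₁ - x) = 1 := by
            field_simp
            ring
          have e2 : (t₁ - x) / (s₁ - x) * s₁ + (s₁ - t₁) / (s₁ - x) * x = t₁ := by
            field_simp
            ring
          have e1' := congrArg (C : ℝ → ℝ[X]) e1
          have e2' := congrArg (C : ℝ → ℝ[X]) e2
          simp only [map_add, map_mul, map_one] at e1' e2'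
          linear_combination (-X * φ) * e1' + φ * e2'
        rw [e]
        exact add _ _ (smul _ _ (div_nonneg (by linarith) hpos.le) hP)
          (smul _ _ (div_nonneg (by linarith) hpos.le) hP')
    have hX : (X - C (-1) : ℝ[X]) = X + 1 := by simp
    have hstep1 : P ((X + 1) * rootsProd ss) := step s₁ (by simp) _ (by simp)
    rw [rootsProd_cons]
    -- Fix `t₁` and induct on the remaining zeros. The lower endpoint for `between` is `-1` in the
    -- base case and the removed zero `x` in the step; both use that `(X + 1) * rootsProd ss` is in
    -- the cone.
    refine ih h4 (by simpa using hl) (fun x hx => hs x (by simp [hx]))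
      (fun x hx => ht x (by simp [hx])) (fun f => P ((X - C t₁) * f))
      (fun f g hf hg => by rw [mul_add]; exact add _ _ hf hg)
      (fun c f hc hf => by rw [mul_left_comm]; exact smul _ _ hc hf) ?_ ?_
    · exact between (-1) _ ht₁ (by simpa using base) (by rw [hX]; exact hstep1)
    · intro x hx ψ hψ
      refine between x _ (h3 x hx) ?_ ?_
      · rw [mul_left_comm]
        refine step x (by simp [hx]) _ ?_
        rw [rootsProd_cons, hψ]
        ring
      · rw [mul_left_comm, ← hψ]
        exact hstep1

end Interleaving

/-! ### Interlacing as a condition on arguments in the upper half-plane. -/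

section Argument

/-- The sum of the arguments of `z - s` over the entries `s` of a list. -/
noncomputable def argSum (z : ℂ) (l : List ℝ) : ℝ := (l.map fun s : ℝ => (z - s).arg).sum

@[simp] theorem argSum_nil (z : ℂ) : argSum z [] = 0 := rfl

@[simp] theorem argSum_cons (z : ℂ) (s : ℝ) (l : List ℝ) :
    argSum z (s :: l) = (z - s).arg + argSum z l := by simp [argSum]

theorem aeval_rootsProd {z : ℂ} (hz : 0 < z.im) (l : List ℝ) :
    ∃ r : ℝ, 0 < r ∧ aeval z (rootsProd l) = r * Complex.exp (argSum z l * Complex.I) := by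
  induction l with
  | nil => exact ⟨1, one_pos, by simp⟩
  | cons s l ih =>
    obtain ⟨r, hr, e⟩ := ih
    have hne : z - s ≠ 0 := fun h => by
      have := congrArg Complex.im h
      simp at this
      linarith
    refine ⟨‖z - s‖ * r, by positivity, ?_⟩
    rw [rootsProd_cons, map_mul, e, argSum_cons]
    push_cast
    rw [add_mul, Complex.exp_add]
    have : aeval z (X - C s) = z - s := by simp
    rw [this]
    conv_lhs => rw [← Complex.norm_mul_exp_arg_mul_I (z - s)]
    ring

theorem im_aeval_rootsProd {z : ℂ} (hz : 0 < z.im) (s t : List ℝ) :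
    ∃ r : ℝ, 0 < r ∧ (aeval z (rootsProd s) * (starRingEnd ℂ) (aeval z (rootsProd t))).im =
      r * Real.sin (argSum z s - argSum z t) := by
  obtain ⟨a, ha, e1⟩ := aeval_rootsProd hz s
  obtain ⟨b, hb, e2⟩ := aeval_rootsProd hz t
  refine ⟨a * b, mul_pos ha hb, ?_⟩
  have : aeval z (rootsProd s) * (starRingEnd ℂ) (aeval z (rootsProd t)) =
      ((a * b : ℝ) : ℂ) * Complex.exp ((argSum z s - argSum z t : ℝ) * Complex.I) := by
    rw [e1, e2, map_mul, ← Complex.exp_conj, map_mul, Complex.conj_ofReal, Complex.conj_ofReal,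
      Complex.conj_I]
    push_cast
    rw [sub_mul, sub_eq_add_neg, Complex.exp_add, mul_neg]
    ring
  rw [this, Complex.im_ofReal_mul, Complex.exp_ofReal_mul_I_im]

theorem arg_sub_mono {z : ℂ} (hz : 0 < z.im) {s c : ℝ} (h : s ≤ c) :
    (z - s).arg ≤ (z - c).arg := by
  have h1 := Complex.arg_le_pi (z - s)
  have h2 : 0 ≤ (z - c).arg := Complex.arg_nonneg_iff.2 (by simpa using hz.le)
  have h0 : (z - s).arg ≠ Real.pi := fun e => by
    have := (Complex.arg_eq_pi_iff.1 e).2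
    simp at this
    linarith
  obtain ⟨r, hr, e⟩ := im_aeval_rootsProd hz [c] [s]
  by_contra hc
  have h3 : Real.sin ((z - c).arg - (z - s).arg) < 0 :=
    Real.sin_neg_of_neg_of_neg_pi_lt (by linarith) (by
      have := lt_of_le_of_ne h1 h0
      linarith)
  simp at e
  nlinarith [mul_nonneg hz.le (sub_nonneg.2 h), mul_neg_of_pos_of_neg hr h3]

/-- The difference is the alternating sum of the arguments at `s₁ ≥ t₁ ≥ s₂ ≥ ⋯`, whose terms
decrease and are nonnegative. The bound by `arg (z - c)`, sharper than `π`, is what the induction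
needs. -/
theorem Interleaved.argSum_sub_mem {z : ℂ} (hz : 0 < z.im) {s t : List ℝ}
    (h : Interleaved s t) :
    0 ≤ argSum z s - argSum z t ∧
      ∀ c : ℝ, (∀ x ∈ s, x ≤ c) → argSum z s - argSum z t ≤ (z - c).arg := by
  induction h with
  | nil =>
    exact ⟨by simp, fun c _ => by simpa using Complex.arg_nonneg_iff.2 (by simpa using hz.le)⟩
  | @cons s ss ts h _ ih =>
    have h1 := ih.2 s h
    rw [argSum_cons]
    refine ⟨by linarith, fun c hc => ?_⟩
    have := arg_sub_mono hz (hc s (by simp))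
    linarith [ih.1]

theorem Interleaved.im_nonneg {s t : List ℝ} (h : Interleaved s t) {z : ℂ} (hz : 0 < z.im) :
    0 ≤ (aeval z (rootsProd s) * (starRingEnd ℂ) (aeval z (rootsProd t))).im := by
  obtain ⟨r, hr, e⟩ := im_aeval_rootsProd hz s t
  rw [e]
  obtain ⟨h1, h2⟩ := h.argSum_sub_mem hz
  obtain ⟨c, hc⟩ : ∃ c, ∀ x ∈ s, x ≤ c := by
    obtain ⟨c, hc⟩ := s.toFinset.bddAbove
    exact ⟨c, fun x hx => hc (by simpa using hx)⟩
  exact mul_nonneg hr.le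
    (Real.sin_nonneg_of_nonneg_of_le_pi h1 ((h2 c hc).trans (Complex.arg_le_pi _)))

theorem continuousOn_argSum (l : List ℝ) :
    ContinuousOn (fun z => argSum z l) {z : ℂ | 0 < z.im} := by
  induction l with
  | nil => simpa using continuousOn_const
  | cons s l ih =>
    simp only [argSum_cons]
    refine ContinuousOn.add (fun z hz => ?_) ih
    refine ContinuousAt.continuousWithinAt ?_
    refine ContinuousAt.comp (g := Complex.arg) (f := fun z : ℂ => z - s)
      (Complex.continuousAt_arg ?_) (by fun_prop)
    exact Complex.mem_slitPlane_iff.2 (Or.inr (by simpa using (ne_of_gt hz)))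

open Filter Topology in
-- Approaching the real point `c` from above, each zero to the right of `c` contributes `π` and each
-- zero to the left contributes `0`, so arguments count zeros.
theorem tendsto_argSum (l : List ℝ) {c : ℝ} (hc : c ∉ l) :
    Tendsto (fun ε : ℝ => argSum (c + ε * Complex.I) l) (𝓝[>] 0)
      (𝓝 (Real.pi * (l.countP (c < ·) : ℕ))) := by
  induction l with
  | nil => simp
  | cons s l ih =>
    simp only [argSum_cons]
    have h1 : c ≠ s := fun h => hc (by simp [h])
    have h2 := ih fun h => hc (by simp [h])
    have hlim : Tendsto (fun ε : ℝ => (c : ℂ) + ε * Complex.I - s) (𝓝[>] 0)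
        (𝓝 ((c - s : ℝ) : ℂ)) := by
      have : Continuous fun ε : ℝ => (c : ℂ) + ε * Complex.I - s := by fun_prop
      have := this.tendsto 0
      simp only [Complex.ofReal_zero, zero_mul, add_zero] at this
      push_cast
      exact this.mono_left nhdsWithin_le_nhds
    rcases lt_or_gt_of_ne h1 with hlt | hgt
    · have h3 : Tendsto (fun ε : ℝ => ((c : ℂ) + ε * Complex.I - s).arg) (𝓝[>] 0) (𝓝 Real.pi) := by
        refine (Complex.tendsto_arg_nhdsWithin_im_nonneg_of_re_neg_of_im_zero
          (z := ((c - s : ℝ) : ℂ)) (by simpa using hlt) (by simp)).comp ?_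
        refine tendsto_nhdsWithin_iff.2 ⟨hlim, ?_⟩
        filter_upwards [self_mem_nhdsWithin] with ε hε
        simpa using le_of_lt hε
      convert h3.add h2 using 2
      rw [List.countP_cons_of_pos (by simpa using hlt)]
      push_cast
      ring
    · have h3 : Tendsto (fun ε : ℝ => ((c : ℂ) + ε * Complex.I - s).arg) (𝓝[>] 0) (𝓝 0) := by
        have := (Complex.continuousAt_arg (x := ((c - s : ℝ) : ℂ))
          (Complex.mem_slitPlane_iff.2 (Or.inl (by simpa using hgt)))).tendsto.comp hlim
        rwa [Complex.arg_ofReal_of_nonneg (by linarith)] at this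
      convert h3.add h2 using 2
      rw [List.countP_cons_of_neg (by simpa using hgt.le)]
      simp

open Filter Topology in
-- The sine of the difference is nonnegative, so its values lie in the intervals `[2kπ, (2k + 1)π]`.
-- It is continuous on a connected set and near `0` close to a real point right of all zeros, so it
-- stays in the interval with `k = 0`.
theorem argSum_sub_mem_Icc {s t : List ℝ}
    (h : ∀ z : ℂ, 0 < z.im →
      0 ≤ (aeval z (rootsProd s) * (starRingEnd ℂ) (aeval z (rootsProd t))).im)
    {z : ℂ} (hz : 0 < z.im) : argSum z s - argSum z t ∈ Set.Icc 0 Real.pi := by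
  have hsin : ∀ z : ℂ, 0 < z.im → 0 ≤ Real.sin (argSum z s - argSum z t) := by
    intro z hz
    obtain ⟨r, hr, e⟩ := im_aeval_rootsProd hz s t
    have := h z hz
    rw [e] at this
    exact nonneg_of_mul_nonneg_right this hr
  obtain ⟨c, hc⟩ : ∃ c, ∀ x ∈ s ++ t, x < c := by
    obtain ⟨c, hc⟩ := (s ++ t).toFinset.bddAbove
    refine ⟨c + 1, fun x hx => ?_⟩
    have := hc (a := x) (by simpa using hx)
    linarith
  have hc0 : ∀ l : List ℝ, (∀ x ∈ l, x < c) → Tendsto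
      (fun ε : ℝ => argSum (c + ε * Complex.I) l) (𝓝[>] 0) (𝓝 0) := by
    intro l hl
    have := tendsto_argSum l (c := c) fun hm => lt_irrefl _ (hl c hm)
    rwa [List.countP_eq_zero.2 fun x hx => by simpa using (hl x hx).le, Nat.cast_zero,
      mul_zero] at this
  have hlim := (hc0 s fun x hx => hc x (by simp [hx])).sub (hc0 t fun x hx => hc x (by simp [hx]))
  rw [sub_zero] at hlim
  have hpi := Real.pi_pos
  obtain ⟨ε, ⟨h1, h2⟩, hε⟩ := ((hlim.eventually (Ioo_mem_nhds
    (by linarith : -(Real.pi / 2) < 0) (by linarith : 0 < Real.pi / 2))).and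
    self_mem_nhdsWithin).exists
  have hε : 0 < ε := hε
  set w : ℂ := c + ε * Complex.I
  have hw : 0 < w.im := by simpa [w] using hε
  have hcont : ContinuousOn (fun z => argSum z s - argSum z t) {z : ℂ | 0 < z.im} :=
    (continuousOn_argSum s).sub (continuousOn_argSum t)
  have hconn : IsPreconnected {z : ℂ | 0 < z.im} := (convex_halfSpace_im_gt 0).isPreconnected
  constructor
  · by_contra hneg
    have hneg := not_le.1 hneg
    have hle : argSum z s - argSum z t ≤ argSum w s - argSum w t := by
      by_contra hlt
      exact absurd (hsin w hw) (not_le.2 (Real.sin_neg_of_neg_of_neg_pi_lt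
        (by linarith) (by linarith)))
    -- Cutting off at `-π/2` gives an attained value in `(-π, 0)`, where the sine is negative;
    -- below, cutting off at `3π/2` does the same in `(π, 2π)`.
    obtain ⟨v, hv, hv2⟩ := hconn.intermediate_value hz hw hcont
      (show max (argSum z s - argSum z t) (-(Real.pi / 2)) ∈ _ from
        ⟨le_max_left _ _, max_le_iff.2 ⟨hle, h1.le⟩⟩)
    have := hsin v hv
    simp only at hv2
    rw [hv2] at this
    refine absurd this (not_le.2 (Real.sin_neg_of_neg_of_neg_pi_lt ?_ ?_))
    · exact max_lt hneg (by linarith)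
    · exact lt_max_of_lt_right (by linarith)
  · by_contra hgt
    have hgt := not_le.1 hgt
    obtain ⟨v, hv, hv2⟩ := hconn.intermediate_value hw hz hcont
      (show min (argSum z s - argSum z t) (Real.pi + Real.pi / 2) ∈ _ from
        ⟨le_min (by linarith) (by linarith), min_le_left _ _⟩)
    have := hsin v hv
    simp only at hv2
    rw [hv2] at this
    have h3 : Real.sin (min (argSum z s - argSum z t) (Real.pi + Real.pi / 2) - Real.pi) > 0 :=
      Real.sin_pos_of_pos_of_lt_pi
        (by have := lt_min hgt (by linarith : Real.pi < Real.pi + Real.pi / 2); linarith)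
        (by have := min_le_right (argSum z s - argSum z t) (Real.pi + Real.pi / 2); linarith)
    rw [Real.sin_sub_pi] at h3
    linarith

theorem countP_mem_of_im_nonneg {s t : List ℝ}
    (h : ∀ z : ℂ, 0 < z.im →
      0 ≤ (aeval z (rootsProd s) * (starRingEnd ℂ) (aeval z (rootsProd t))).im)
    {c : ℝ} (hs : c ∉ s) (ht : c ∉ t) :
    t.countP (c < ·) ≤ s.countP (c < ·) ∧ s.countP (c < ·) ≤ t.countP (c < ·) + 1 := by
  have hlim := (tendsto_argSum s hs).sub (tendsto_argSum t ht)
  have hmem := isClosed_Icc.mem_of_tendsto hlim (b := nhdsWithin 0 (Set.Ioi 0)) (by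
    filter_upwards [self_mem_nhdsWithin] with ε hε
    exact argSum_sub_mem_Icc h (by simpa using hε))
  have hpi := Real.pi_pos
  constructor
  · have : (t.countP (c < ·) : ℝ) ≤ (s.countP (c < ·) : ℕ) := by nlinarith [hmem.1]
    exact_mod_cast this
  · have : (s.countP (c < ·) : ℝ) ≤ (t.countP (c < ·) : ℕ) + 1 := by nlinarith [hmem.2]
    exact_mod_cast this

theorem lt_countP_of_lt_getElem {l : List ℝ} (hl : l.Pairwise (· ≥ ·)) {c : ℝ} {i : ℕ}
    (hi : i < l.length) (h : c < l[i]) : i < l.countP (c < ·) := by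
  have h1 : (l.take (i + 1)).countP (c < ·) = (l.take (i + 1)).length := by
    rw [List.countP_eq_length]
    intro x hx
    obtain ⟨j, hj, rfl⟩ := List.getElem_of_mem hx
    have hj' : j ≤ i := by simp at hj; omega
    rw [List.getElem_take]
    rcases eq_or_lt_of_le hj' with rfl | hlt
    · simpa using h
    · have := List.pairwise_iff_getElem.1 hl j i (by omega) hi hlt
      simp only [decide_eq_true_eq]
      linarith
  have h2 := (List.take_sublist (i + 1) l).countP_le (p := (c < ·))
  rw [h1, List.length_take] at h2
  omega

theorem countP_le_of_getElem_le {l : List ℝ} (hl : l.Pairwise (· ≥ ·)) {c : ℝ} {i : ℕ}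
    (hi : i < l.length) (h : l[i] ≤ c) : l.countP (c < ·) ≤ i := by
  have h1 : (l.drop i).countP (c < ·) = 0 := by
    rw [List.countP_eq_zero]
    intro x hx
    obtain ⟨j, hj, rfl⟩ := List.getElem_of_mem hx
    rw [List.getElem_drop]
    simp only [decide_eq_true_eq, not_lt]
    rcases Nat.eq_zero_or_pos j with rfl | hlt
    · simpa using h
    · have := List.pairwise_iff_getElem.1 hl i (i + j) hi (by simp at hj; omega) (by omega)
      linarith
  rw [← List.take_append_drop i l, List.countP_append, h1, add_zero]
  exact List.countP_le_length.trans (by simp)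

theorem exists_between_notMem {x y : ℝ} (h : x < y) (l : List ℝ) : ∃ c, x < c ∧ c < y ∧ c ∉ l := by
  obtain ⟨c, hc, hc'⟩ := (Set.Ioo_infinite h).exists_notMem_finset l.toFinset
  exact ⟨c, hc.1, hc.2, by simpa using hc'⟩

end Argument

/-! ### Real-rooted polynomials and the diamond product of interlacing pairs. -/

section RealPolynomials

theorem eq_C_mul_rootsProd {f : ℝ[X]} (hf : f.Splits) :
    f = C f.leadingCoeff * rootsProd (zerosDesc f) := by
  conv_lhs => rw [hf.eq_prod_roots]
  rw [rootsProd, zerosDesc, ← Multiset.prod_coe, ← Multiset.map_coe, Multiset.sort_eq]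

theorem pairwise_zerosDesc (f : ℝ[X]) : (zerosDesc f).Pairwise (· ≥ ·) :=
  Multiset.pairwise_sort _ _

theorem mem_zerosDesc {f : ℝ[X]} (h0 : f ≠ 0) {s : ℝ} : s ∈ zerosDesc f ↔ f.IsRoot s := by
  rw [zerosDesc, Multiset.mem_sort, mem_roots h0]

theorem length_zerosDesc {f : ℝ[X]} (hf : f.Splits) : (zerosDesc f).length = f.natDegree := by
  rw [zerosDesc, Multiset.length_sort, hf.natDegree_eq_card_roots]

theorem im_aeval_eq {f g : ℝ[X]} (hf : f.Splits) (hg : g.Splits) (z : ℂ) :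
    (aeval z f * (starRingEnd ℂ) (aeval z g)).im = f.leadingCoeff * g.leadingCoeff *
      (aeval z (rootsProd (zerosDesc f)) *
        (starRingEnd ℂ) (aeval z (rootsProd (zerosDesc g)))).im := by
  conv_lhs => rw [eq_C_mul_rootsProd hf, eq_C_mul_rootsProd hg]
  rw [← Complex.im_ofReal_mul]
  congr 1
  simp only [map_mul, aeval_C, Complex.coe_algebraMap, Complex.conj_ofReal]
  push_cast
  ring

theorem Interlaces.interleaved {a b : ℝ[X]} (h : Interlaces b a) (ha : a ≠ 0) (hb : b ≠ 0) :
    Interleaved (zerosDesc a) (zerosDesc b) := by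
  obtain ⟨-, -, h | h | ⟨h1, h2, h3, h4⟩⟩ := h
  · exact absurd h hb
  · exact absurd h ha
  · exact interleaved_of_getElem _ rfl (pairwise_zerosDesc a) (pairwise_zerosDesc b) h1 h2 h3 h4

theorem leadingCoeff_pos_of_coeff_nonneg {a : ℝ[X]} (ha : ∀ i, 0 ≤ a.coeff i) (h0 : a ≠ 0) :
    0 < a.leadingCoeff :=
  lt_of_le_of_ne (ha _) (Ne.symm (leadingCoeff_ne_zero.2 h0))

theorem Interlaces.im_nonneg {a b : ℝ[X]} (h : Interlaces b a) (ha : ∀ i, 0 ≤ a.coeff i)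
    (hb : ∀ i, 0 ≤ b.coeff i) {z : ℂ} (hz : 0 < z.im) :
    0 ≤ (aeval z a * (starRingEnd ℂ) (aeval z b)).im := by
  rcases eq_or_ne a 0 with rfl | ha0
  · simp
  rcases eq_or_ne b 0 with rfl | hb0
  · simp
  rw [im_aeval_eq h.2.1 h.1]
  exact mul_nonneg (mul_nonneg (ha _) (hb _)) ((h.interleaved ha0 hb0).im_nonneg hz)

/-- A violated inequality leaves room for a point `e`, outside both lists, at which the numbers of
larger entries contradict `countP_mem_of_im_nonneg`. A point left of all entries compares the
lengths. -/
theorem getElem_le_of_im_nonneg {s t : List ℝ} (hs : s.Pairwise (· ≥ ·))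
    (ht : t.Pairwise (· ≥ ·))
    (h : ∀ z : ℂ, 0 < z.im →
      0 ≤ (aeval z (rootsProd s) * (starRingEnd ℂ) (aeval z (rootsProd t))).im) :
    t.length ≤ s.length ∧ s.length ≤ t.length + 1 ∧
    (∀ (i : ℕ) (hs : i < s.length) (ht : i < t.length), t[i] ≤ s[i]) ∧
    (∀ (i : ℕ) (hs : i + 1 < s.length) (ht : i < t.length), s[i + 1] ≤ t[i]) := by
  obtain ⟨c, hc⟩ : ∃ c, ∀ x ∈ s ++ t, c < x := by
    obtain ⟨c, hc⟩ := (s ++ t).toFinset.bddBelow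
    refine ⟨c - 1, fun x hx => ?_⟩
    have := hc (a := x) (by simpa using hx)
    linarith
  have hlen : ∀ l : List ℝ, (∀ x ∈ l, c < x) → l.countP (c < ·) = l.length := fun l hl =>
    List.countP_eq_length.2 fun x hx => by simpa using hl x hx
  have h1 := countP_mem_of_im_nonneg h (c := c)
    (fun hm => lt_irrefl _ (hc c (by simp [hm]))) (fun hm => lt_irrefl _ (hc c (by simp [hm])))
  rw [hlen s fun x hx => hc x (by simp [hx]), hlen t fun x hx => hc x (by simp [hx])] at h1
  refine ⟨h1.1, h1.2, fun i hi hi' => ?_, fun i hi hi' => ?_⟩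
  · by_contra hlt
    obtain ⟨e, he1, he2, he3⟩ := exists_between_notMem (not_le.1 hlt) (s ++ t)
    simp only [List.mem_append, not_or] at he3
    have := countP_mem_of_im_nonneg h he3.1 he3.2
    have := lt_countP_of_lt_getElem ht hi' he2
    have := countP_le_of_getElem_le hs hi he1.le
    omega
  · by_contra hlt
    obtain ⟨e, he1, he2, he3⟩ := exists_between_notMem (not_le.1 hlt) (s ++ t)
    simp only [List.mem_append, not_or] at he3
    have := countP_mem_of_im_nonneg h he3.1 he3.2
    have := lt_countP_of_lt_getElem hs hi he2
    have := countP_le_of_getElem_le ht hi' he1.le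
    omega

theorem interlaces_of_im_nonneg {a b : ℝ[X]} (ha : a.Splits) (hb : b.Splits)
    (ha' : ∀ i, 0 ≤ a.coeff i) (hb' : ∀ i, 0 ≤ b.coeff i)
    (h : ∀ z : ℂ, 0 < z.im → 0 ≤ (aeval z a * (starRingEnd ℂ) (aeval z b)).im) :
    Interlaces b a := by
  refine ⟨hb, ha, ?_⟩
  rcases eq_or_ne b 0 with hb0 | hb0
  · exact .inl hb0
  rcases eq_or_ne a 0 with ha0 | ha0
  · exact .inr (.inl ha0)
  refine .inr (.inr (getElem_le_of_im_nonneg (pairwise_zerosDesc a) (pairwise_zerosDesc b)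
    fun z hz => ?_))
  have := h z hz
  rw [im_aeval_eq ha hb] at this
  exact nonneg_of_mul_nonneg_right this
    (mul_pos (leadingCoeff_pos_of_coeff_nonneg ha' ha0) (leadingCoeff_pos_of_coeff_nonneg hb' hb0))

theorem splits_of_aeval_ne_zero {f : ℝ[X]} (h : ∀ z : ℂ, 0 < z.im → aeval z f ≠ 0) :
    f.Splits := by
  refine Splits.of_splits_map (algebraMap ℝ ℂ) (IsAlgClosed.splits _) fun z hz => ?_
  have hz0 : aeval z f = 0 := by
    have := isRoot_of_mem_roots hz
    rwa [IsRoot, eval_map_algebraMap] at this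
  rcases lt_trichotomy z.im 0 with hlt | he | hgt
  · refine absurd ?_ (h ((starRingEnd ℂ) z) (by simpa using hlt))
    rw [aeval_conj, hz0, map_zero]
  · exact ⟨z.re, Complex.ext (by simp) (by simp [he])⟩
  · exact absurd hz0 (h z hgt)

theorem Polynomial.Splits.aeval_ne_zero {f : ℝ[X]} (hf : f.Splits) (h0 : f ≠ 0) {z : ℂ}
    (hz : z.im ≠ 0) : aeval z f ≠ 0 := by
  rw [eq_C_mul_rootsProd hf, map_mul, aeval_C]
  refine mul_ne_zero (by simpa using h0) ?_
  generalize zerosDesc f = l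
  induction l with
  | nil => simp
  | cons s l ih =>
    rw [rootsProd_cons, map_mul]
    refine mul_ne_zero (fun h => hz ?_) ih
    have := congrArg Complex.im h
    simpa using this

/-- A nonzero real-rooted polynomial whose zeros lie in `[-1, 0]`. -/
structure UnitRooted (f : ℝ[X]) : Prop where
  ne_zero : f ≠ 0
  splits : f.Splits
  mem : ∀ s, f.IsRoot s → -1 ≤ s ∧ s ≤ 0

namespace UnitRooted

theorem mul {f g : ℝ[X]} (hf : UnitRooted f) (hg : UnitRooted g) : UnitRooted (f * g) :=
  ⟨mul_ne_zero hf.1 hg.1, hf.2.mul hg.2, fun s hs => by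
    rcases root_mul.1 hs with h | h
    · exact hf.3 s h
    · exact hg.3 s h⟩

theorem X_add_one_mul {f : ℝ[X]} (hf : UnitRooted f) : UnitRooted ((X + 1) * f) := by
  refine mul ⟨by simpa using X_add_C_ne_zero (1 : ℝ), by simpa using Splits.X_add_C (1 : ℝ),
    fun s hs => ?_⟩ hf
  obtain rfl : s = -1 := by
    have : s + 1 = 0 := by simpa using hs
    linarith
  norm_num

theorem of_mul_left {f g : ℝ[X]} (h : UnitRooted (f * g)) : UnitRooted g :=
  ⟨right_ne_zero_of_mul h.1, h.2.of_dvd h.1 (dvd_mul_left _ _),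
    fun s hs => h.3 s (root_mul.2 (.inr hs))⟩

theorem isStable {f : ℝ[X]} (hf : UnitRooted f) : IsStable (f.map (algebraMap ℝ ℂ)) := by
  intro z hz
  rw [eval_map_algebraMap]
  exact hf.splits.aeval_ne_zero hf.ne_zero hz.ne'

theorem rootsInUnit {f : ℝ[X]} (hf : UnitRooted f) :
    RootsInUnit (f.map (algebraMap ℝ ℂ)) := by
  refine ⟨by simpa using hf.ne_zero, fun z hz => ?_⟩
  rw [eval_map_algebraMap] at hz
  have him : z.im = 0 := by
    by_contra h
    exact hf.splits.aeval_ne_zero hf.ne_zero h hz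
  have hre : z = (z.re : ℂ) := Complex.ext (by simp) (by simp [him])
  refine ⟨z.re, hre, hf.mem _ ?_⟩
  rw [hre] at hz
  have : ((f.eval z.re : ℝ) : ℂ) = 0 := by
    rw [← hz]
    simpa using (aeval_algebraMap_apply ℂ z.re f).symm
  exact_mod_cast this

theorem aeval_diamond_ne_zero {f g : ℝ[X]} (hf : UnitRooted f) (hg : UnitRooted g) {z : ℂ}
    (hz : 0 < z.im) : aeval z (diamond f g) ≠ 0 := by
  have := hg.isStable.diamond hf.rootsInUnit z hz
  rwa [diamond_map, eval_map_algebraMap] at this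

/-- If the quotient of the two products had a value `y` with `Im y ≤ 0` at `z`, then `(X - y) f`
would be stable while its diamond product with `g` vanishes at `z`. -/
theorem im_diamond_X_mul_pos {f g : ℝ[X]} (hf : UnitRooted f) (hg : UnitRooted g) {z : ℂ}
    (hz : 0 < z.im) :
    0 < (aeval z (diamond (X * f) g) * (starRingEnd ℂ) (aeval z (diamond f g))).im := by
  by_contra hle
  set a := aeval z (diamond (X * f) g)
  set c := aeval z (diamond f g)
  have hc : c ≠ 0 := hf.aeval_diamond_ne_zero hg hz
  have hy : (a / c).im ≤ 0 := by
    have : a / c = ((Complex.normSq c)⁻¹ : ℝ) * (a * (starRingEnd ℂ) c) := by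
      rw [div_eq_mul_inv, Complex.inv_def]
      ring
    rw [this, Complex.im_ofReal_mul]
    exact mul_nonpos_of_nonneg_of_nonpos (inv_nonneg.2 (Complex.normSq_nonneg c)) (not_lt.1 hle)
  have hs : IsStable ((X - C (a / c)) * f.map (algebraMap ℝ ℂ)) := by
    intro w hw
    rw [eval_mul]
    refine mul_ne_zero (fun h => ?_) (hf.isStable w hw)
    have := congrArg Complex.im h
    simp only [eval_sub, eval_X, eval_C, Complex.sub_im, Complex.zero_im] at this
    linarith
  have := hs.diamond hg.rootsInUnit z hz
  rw [sub_mul, diamond_sub_right, diamond_C_mul_right, diamond_map, eval_sub, eval_mul, eval_C,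
    show (X : ℂ[X]) = X.map (algebraMap ℝ ℂ) by simp, ← Polynomial.map_mul, diamond_map,
    eval_map_algebraMap, eval_map_algebraMap, diamond_comm g, diamond_comm g] at this
  exact this (by
    change a - a / c * c = 0
    field_simp
    ring)

theorem im_diamond_X_mul_nonneg {f g : ℝ[X]} (hf : UnitRooted f) (hg : UnitRooted g) {z : ℂ}
    (hz : 0 < z.im) :
    0 ≤ (aeval z (diamond (X * f) g) *
      (starRingEnd ℂ) (aeval z (diamond ((X + 1) * f) g))).im := by
  have h := hf.im_diamond_X_mul_pos hg hz
  rw [add_mul, one_mul, diamond_add_left, map_add, map_add, mul_add, Complex.add_im,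
    Complex.mul_conj, Complex.ofReal_im, zero_add]
  exact h.le

end UnitRooted

/-- Two polynomials with zeros in `[-1, 0]`, the same degree and the same positive leading
coefficient, the first of which interlaces the second. -/
structure IsInterlacingPair (f₁ f₂ : ℝ[X]) : Prop where
  left : UnitRooted f₁
  right : UnitRooted f₂
  natDegree_eq : f₁.natDegree = f₂.natDegree
  leadingCoeff_eq : f₁.leadingCoeff = f₂.leadingCoeff
  leadingCoeff_pos : 0 < f₂.leadingCoeff
  im_nonneg : ∀ z : ℂ, 0 < z.im → 0 ≤ (aeval z f₂ * (starRingEnd ℂ) (aeval z f₁)).im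

namespace IsInterlacingPair

theorem cone_induction {f₁ f₂ : ℝ[X]} (h : IsInterlacingPair f₁ f₂) (P : ℝ[X] → Prop)
    (add : ∀ f g, P f → P g → P (f + g))
    (smul : ∀ (c : ℝ) f, 0 ≤ c → P f → P (C c * f)) (base : P f₂)
    (step : ∀ s φ, f₂ = (X - C s) * φ → -1 ≤ s → s ≤ 0 → UnitRooted φ → P ((X + 1) * φ)) :
    P f₁ := by
  have e1 := eq_C_mul_rootsProd h.left.splits
  have e2 := eq_C_mul_rootsProd h.right.splits
  have hint : Interleaved (zerosDesc f₂) (zerosDesc f₁) := by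
    obtain ⟨h1, h2, h3, h4⟩ := getElem_le_of_im_nonneg (pairwise_zerosDesc f₂)
      (pairwise_zerosDesc f₁) fun z hz => by
        have := h.im_nonneg z hz
        rw [im_aeval_eq h.right.splits h.left.splits] at this
        exact nonneg_of_mul_nonneg_right this
          (mul_pos h.leadingCoeff_pos (h.leadingCoeff_eq ▸ h.leadingCoeff_pos))
    exact interleaved_of_getElem _ rfl (pairwise_zerosDesc f₂) (pairwise_zerosDesc f₁) h1 h2 h3 h4
  rw [e1, h.leadingCoeff_eq]
  refine hint.cone_induction (by
      rw [length_zerosDesc h.right.splits, length_zerosDesc h.left.splits, h.natDegree_eq])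
    (fun x hx => (h.right.mem x ((mem_zerosDesc h.right.ne_zero).1 hx)).1)
    (fun x hx => (h.left.mem x ((mem_zerosDesc h.left.ne_zero).1 hx)).1)
    (fun f => P (C f₂.leadingCoeff * f)) (fun f g hf hg => by rw [mul_add]; exact add _ _ hf hg)
    (fun c f hc hf => by rw [mul_left_comm]; exact smul _ _ hc hf) (by rwa [← e2]) ?_
  intro x hx ψ hψ
  have hx' := h.right.mem x ((mem_zerosDesc h.right.ne_zero).1 hx)
  have e : f₂ = (X - C x) * (C f₂.leadingCoeff * ψ) := by
    rw [mul_left_comm, ← hψ]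
    exact e2
  rw [mul_left_comm]
  exact step x _ e hx'.1 hx'.2 (UnitRooted.of_mul_left (e ▸ h.right))

theorem im_add_nonneg {u v k : ℂ} (hu : 0 ≤ (u * (starRingEnd ℂ) k).im)
    (hv : 0 ≤ (v * (starRingEnd ℂ) k).im) : 0 ≤ ((u + v) * (starRingEnd ℂ) k).im := by
  rw [add_mul, Complex.add_im]
  exact add_nonneg hu hv

theorem im_C_mul_nonneg {u : ℝ[X]} {z k : ℂ} {c : ℝ} (hc : 0 ≤ c)
    (hu : 0 ≤ (aeval z u * (starRingEnd ℂ) k).im) :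
    0 ≤ (aeval z (C c * u) * (starRingEnd ℂ) k).im := by
  rw [map_mul, aeval_C, Complex.coe_algebraMap, mul_assoc, Complex.im_ofReal_mul]
  exact mul_nonneg hc hu

theorem im_diamond_step_left {φ g : ℝ[X]} (hφ : UnitRooted φ) (hg : UnitRooted g) {s : ℝ}
    (h1 : -1 ≤ s) (h2 : s ≤ 0) {z : ℂ} (hz : 0 < z.im) :
    0 ≤ (aeval z (diamond ((X - C s) * φ) g) *
      (starRingEnd ℂ) (aeval z (diamond ((X + 1) * φ) g))).im := by
  -- `x - s = (1 + s) x + (-s) (x + 1)` with nonnegative weights, as `s ∈ [-1, 0]`.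
  have e : diamond ((X - C s) * φ) g =
      C (1 + s) * diamond (X * φ) g + C (-s) * diamond ((X + 1) * φ) g := by
    simp only [sub_mul, add_mul, one_mul, diamond_sub_left, diamond_add_left, diamond_C_mul_left,
      map_add, map_neg, C_1]
    ring
  rw [e, map_add]
  exact im_add_nonneg (im_C_mul_nonneg (by linarith) (hφ.im_diamond_X_mul_nonneg hg hz))
    (im_C_mul_nonneg (by linarith) (by rw [Complex.mul_conj, Complex.ofReal_im]))

theorem im_diamond_step_both {φ ψ : ℝ[X]} (hφ : UnitRooted φ) (hψ : UnitRooted ψ) {s t : ℝ}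
    (h1 : -1 ≤ s) (h2 : s ≤ 0) (h3 : -1 ≤ t) (h4 : t ≤ 0) {z : ℂ} (hz : 0 < z.im) :
    0 ≤ (aeval z (diamond ((X - C s) * φ) ((X - C t) * ψ)) *
      (starRingEnd ℂ) (aeval z (diamond ((X + 1) * φ) ((X + 1) * ψ)))).im := by
  have e : diamond ((X - C s) * φ) ((X - C t) * ψ) =
      (C ((1 + s) * (1 + t)) * diamond (X * φ) (X * ψ) +
        C ((1 + s) * (-t)) * diamond (X * φ) ((X + 1) * ψ)) +
      C (-s) * diamond ((X - C t) * ψ) ((X + 1) * φ) := by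
    simp only [sub_mul, add_mul, one_mul, diamond_sub_left, diamond_C_mul_left,
      map_add, map_neg, C_1, diamond_sub_right, diamond_add_right, diamond_C_mul_right, map_mul,
      diamond_comm ψ, diamond_comm (X * ψ)]
    ring
  rw [e, map_add, map_add]
  refine im_add_nonneg (im_add_nonneg ?_ ?_) ?_
  · refine im_C_mul_nonneg (mul_nonneg (by linarith) (by linarith)) ?_
    -- The two products share the bracket `G`, so only `Im (z * conj (z + 1)) = Im z` matters.
    rw [diamond_X_mul_X_mul, diamond_X_add_one_mul]
    generalize diamond φ ψ + diamond (X * φ) ψ + diamond φ (X * ψ) = G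
    have hX : aeval z (X + 1 : ℝ[X]) = z + 1 := by simp
    rw [map_mul, map_mul, aeval_X, hX, map_mul, mul_mul_mul_comm, Complex.mul_conj, mul_comm,
      Complex.im_ofReal_mul]
    refine mul_nonneg (Complex.normSq_nonneg _) ?_
    rw [map_add, mul_add, map_one, Complex.mul_conj, mul_one, Complex.add_im, Complex.ofReal_im,
      zero_add]
    exact hz.le
  · exact im_C_mul_nonneg (mul_nonneg (by linarith) (by linarith))
      (hφ.im_diamond_X_mul_nonneg hψ.X_add_one_mul hz)
  · rw [diamond_comm ((X + 1) * φ)]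
    exact im_C_mul_nonneg (by linarith)
      (im_diamond_step_left hψ hφ.X_add_one_mul h3 h4 hz)

theorem im_diamond_nonneg {f₁ f₂ g₁ g₂ : ℝ[X]} (hf : IsInterlacingPair f₁ f₂)
    (hg : IsInterlacingPair g₁ g₂) {z : ℂ} (hz : 0 < z.im) :
    0 ≤ (aeval z (diamond f₂ g₂) * (starRingEnd ℂ) (aeval z (diamond f₁ g₁))).im := by
  have add : ∀ {u v w : ℂ}, 0 ≤ (w * (starRingEnd ℂ) u).im → 0 ≤ (w * (starRingEnd ℂ) v).im →
      0 ≤ (w * (starRingEnd ℂ) (u + v)).im := fun hu hv => by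
    rw [map_add, mul_add, Complex.add_im]
    exact add_nonneg hu hv
  have smul : ∀ (c : ℝ) {u : ℝ[X]} {w : ℂ}, 0 ≤ c → 0 ≤ (w * (starRingEnd ℂ) (aeval z u)).im →
      0 ≤ (w * (starRingEnd ℂ) (aeval z (C c * u))).im := fun c _ _ hc hu => by
    rw [map_mul, aeval_C, Complex.coe_algebraMap, map_mul, Complex.conj_ofReal, mul_left_comm,
      Complex.im_ofReal_mul]
    exact mul_nonneg hc hu
  refine hf.cone_induction (fun f => 0 ≤ (aeval z (diamond f₂ g₂) *
    (starRingEnd ℂ) (aeval z (diamond f g₁))).im) (fun f g h1 h2 => ?_) (fun c f hc h => ?_) ?_ ?_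
  · rw [diamond_add_left, map_add]
    exact add h1 h2
  · rw [diamond_C_mul_left]
    exact smul c hc h
  · refine hg.cone_induction (fun g => 0 ≤ (aeval z (diamond f₂ g₂) *
      (starRingEnd ℂ) (aeval z (diamond f₂ g))).im) (fun f g h1 h2 => ?_) (fun c f hc h => ?_)
      ?_ ?_
    · rw [diamond_add_right, map_add]
      exact add h1 h2
    · rw [diamond_C_mul_right]
      exact smul c hc h
    · rw [Complex.mul_conj, Complex.ofReal_im]
    · intro s φ e h1 h2 hφ
      rw [e, diamond_comm, diamond_comm f₂]
      exact im_diamond_step_left hφ hf.right h1 h2 hz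
  · intro s φ e h1 h2 hφ
    refine hg.cone_induction (fun g => 0 ≤ (aeval z (diamond f₂ g₂) *
      (starRingEnd ℂ) (aeval z (diamond ((X + 1) * φ) g))).im)
      (fun f g h1 h2 => ?_) (fun c f hc h => ?_) ?_ ?_
    · rw [diamond_add_right, map_add]
      exact add h1 h2
    · rw [diamond_C_mul_right]
      exact smul c hc h
    · rw [e]
      exact im_diamond_step_left hφ hg.right h1 h2 hz
    · intro t ψ e' h3 h4 hψ
      rw [e, e']
      exact im_diamond_step_both hφ hψ h1 h2 h3 h4 hz

end IsInterlacingPair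

end RealPolynomials

/-! ### Symmetric decompositions after lifting. -/

section SymmetricPairs

/-- The pair `f₁, f₂` of polynomials `(1 + x)^d h(x / (1 + x))` for `h = a + b` and `h = a + x b`,
where `(a, b)` is a nonnegative symmetric decomposition and `A`, `B` correspond to `a`, `b`. -/
structure IsSymmPair (d : ℕ) (f₁ f₂ A B : ℝ[X]) : Prop where
  left_eq : f₁ = A + (X + 1) * B
  right_eq : f₂ = A + X * B
  nonneg_left : IsNonnegLift d A
  nonneg_right : B = 0 ∨ ∃ e, d = e + 1 ∧ IsNonnegLift e B
  left_comp : f₁ = (-1) ^ d * f₂.comp (-1 - X)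
  ne_zero : f₂ ≠ 0

theorem neg_one_pow_mul_self (d : ℕ) : ((-1 : ℝ[X]) ^ d) * (-1) ^ d = 1 := by
  rw [← mul_pow]
  simp

theorem comp_neg_one_sub_X_twice (f : ℝ[X]) : (f.comp (-1 - X)).comp (-1 - X) = f := by
  rw [comp_assoc]
  simp

namespace IsSymmPair

variable {d : ℕ} {f₁ f₂ A B : ℝ[X]}

theorem nonnegLift_left (h : IsSymmPair d f₁ f₂ A B) : IsNonnegLift d f₁ := by
  rw [h.left_eq]
  refine h.nonneg_left.add ?_
  rcases h.nonneg_right with rfl | ⟨e, rfl, hB⟩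
  · simpa using IsNonnegLift.zero d
  · exact hB.X_add_one_mul

theorem nonnegLift_right (h : IsSymmPair d f₁ f₂ A B) : IsNonnegLift d f₂ := by
  rw [h.right_eq]
  refine h.nonneg_left.add ?_
  rcases h.nonneg_right with rfl | ⟨e, rfl, hB⟩
  · simpa using IsNonnegLift.zero d
  · exact hB.X_mul

theorem right_comp (h : IsSymmPair d f₁ f₂ A B) : f₂ = (-1) ^ d * f₁.comp (-1 - X) := by
  rw [h.left_comp, mul_comp, comp_neg_one_sub_X_twice, pow_comp, neg_comp, one_comp, ← mul_assoc,
    neg_one_pow_mul_self, one_mul]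

theorem left_ne_zero (h : IsSymmPair d f₁ f₂ A B) : f₁ ≠ 0 := fun h0 =>
  h.ne_zero (by rw [h.right_comp, h0]; simp)

theorem left_sub_right (h : IsSymmPair d f₁ f₂ A B) : f₁ - f₂ = B := by
  rw [h.left_eq, h.right_eq]
  ring

theorem coeff_right_eq_zero (h : IsSymmPair d f₁ f₂ A B) : B.coeff d = 0 := by
  rcases h.nonneg_right with rfl | ⟨e, rfl, hB⟩
  · simp
  · exact coeff_eq_zero_of_natDegree_lt (by have := hB.natDegree_le; omega)

theorem coeff_eq (h : IsSymmPair d f₁ f₂ A B) : f₁.coeff d = f₂.coeff d := by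
  rw [← sub_eq_zero, ← coeff_sub, h.left_sub_right, h.coeff_right_eq_zero]

/-- A nonzero nonnegative lift is positive on `(0, ∞)`. Applied to `f₂` this excludes positive
zeros; applied to `f₁`, its reflection, it excludes zeros below `-1`. -/
theorem isRoot_mem (h : IsSymmPair d f₁ f₂ A B) {s : ℝ} (hs : f₂.IsRoot s) : -1 ≤ s ∧ s ≤ 0 := by
  constructor
  · by_contra hlt
    have h1 := h.nonnegLift_left.eval_pos h.left_ne_zero (x := -1 - s) (by linarith)
    rw [h.left_comp, eval_mul, eval_comp] at h1
    have : eval (-1 - s) (-1 - X : ℝ[X]) = s := by simp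
    rw [this, hs.eq_zero, mul_zero] at h1
    exact lt_irrefl _ h1
  · by_contra hlt
    have h1 := h.nonnegLift_right.eval_pos h.ne_zero (not_le.1 hlt)
    rw [hs.eq_zero] at h1
    exact lt_irrefl _ h1

theorem unitRooted_right (h : IsSymmPair d f₁ f₂ A B)
    (hst : ∀ z : ℂ, 0 < z.im → aeval z f₂ ≠ 0) : UnitRooted f₂ :=
  ⟨h.ne_zero, splits_of_aeval_ne_zero hst, fun _ => h.isRoot_mem⟩

theorem unitRooted_left (h : IsSymmPair d f₁ f₂ A B) (h₂ : UnitRooted f₂) : UnitRooted f₁ := by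
  refine ⟨h.left_ne_zero, ?_, fun s hs => ?_⟩
  · rw [h.left_comp, show ((-1 : ℝ[X]) ^ d) = C ((-1) ^ d) by simp]
    exact (h₂.splits.comp_of_natDegree_le_one (by compute_degree)).C_mul _
  · have : f₂.IsRoot (-1 - s) := by
      rw [IsRoot, h.right_comp, eval_mul, eval_comp]
      have : eval (-1 - s) (-1 - X : ℝ[X]) = s := by simp
      rw [this, hs.eq_zero, mul_zero]
    have := h₂.mem _ this
    constructor <;> linarith [this.1, this.2]

theorem isInterlacingPair (h : IsSymmPair d f₁ f₂ A B)
    (hst : ∀ z : ℂ, 0 < z.im → aeval z f₂ ≠ 0)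
    (him : ∀ z : ℂ, 0 < z.im → 0 ≤ (aeval z f₂ * (starRingEnd ℂ) (aeval z f₁)).im) :
    IsInterlacingPair f₁ f₂ := by
  have h1 := h.nonnegLift_left.natDegree_eq h.left_ne_zero
  have h2 := h.nonnegLift_right.natDegree_eq h.ne_zero
  exact ⟨h.unitRooted_left (h.unitRooted_right hst), h.unitRooted_right hst, h1.trans h2.symm,
    by rw [leadingCoeff, leadingCoeff, h1, h2, h.coeff_eq],
    h.nonnegLift_right.leadingCoeff_pos h.ne_zero, him⟩

/-- The new second component is `f₁ ◇ g₁ - f₂ ◇ g₂ = (f₁ - f₂) ◇ g₂ + f₁ ◇ (g₁ - g₂)`; the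
recursions for `X * B` and `X * D` then give the first component. Neither formula contains a
subtraction, so both are nonnegative lifts. -/
theorem diamond {e : ℕ} {g₁ g₂ E D : ℝ[X]} (h : IsSymmPair d f₁ f₂ A B)
    (k : IsSymmPair e g₁ g₂ E D) (hne : diamond f₂ g₂ ≠ 0) :
    IsSymmPair (d + e) (diamond f₁ g₁) (diamond f₂ g₂)
      (diamond A E + diamondStep D A + diamondStep B E) (diamond B g₂ + diamond f₁ D) := by
  have hX := diamond_X_mul_X_mul B D
  refine ⟨?_, ?_, ?_, ?_, ?_, hne⟩
  · rw [h.left_eq, k.left_eq, k.right_eq]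
    simp only [add_mul, one_mul, diamond_add_left, diamond_add_right, hX, diamond_X_mul_left B E,
      diamond_X_mul_right A D]
    ring
  · rw [h.left_eq, h.right_eq, k.right_eq]
    simp only [add_mul, one_mul, diamond_add_left, diamond_add_right, hX, diamond_X_mul_left B E,
      diamond_X_mul_right A D]
    ring
  · refine (IsNonnegLift.add (h.nonneg_left.diamond k.nonneg_left) ?_).add ?_
    · rcases k.nonneg_right with rfl | ⟨e, rfl, hD⟩
      · simpa [diamondStep] using IsNonnegLift.zero _
      · have := hD.diamondStep h.nonneg_left
        rwa [add_comm] at this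
    · rcases h.nonneg_right with rfl | ⟨d, rfl, hB⟩
      · simpa [diamondStep] using IsNonnegLift.zero _
      · exact hB.diamondStep k.nonneg_left
  · rcases h.nonneg_right with rfl | ⟨d', hd, hB⟩
    · rcases k.nonneg_right with rfl | ⟨e', he, hD⟩
      · left
        simp
      · right
        refine ⟨d + e', by omega, ?_⟩
        simpa using h.nonnegLift_left.diamond hD
    · right
      refine ⟨d' + e, by omega, (hB.diamond k.nonnegLift_right).add ?_⟩
      rcases k.nonneg_right with rfl | ⟨e', he, hD⟩
      · simpa using IsNonnegLift.zero _
      · have := h.nonnegLift_left.diamond hD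
        rwa [show d + e' = d' + e by omega] at this
  · rw [h.left_comp, k.left_comp, show ((-1 : ℝ[X]) ^ d) = C ((-1) ^ d) by simp,
      show ((-1 : ℝ[X]) ^ e) = C ((-1) ^ e) by simp, diamond_C_mul_left, diamond_C_mul_right,
      diamond_comp_neg_one_sub_X, ← mul_assoc, ← C_mul, ← pow_add]
    simp

/-- The dichotomy that replaces strict positivity: `f₂` and `x B` are proportional, or `f₂ / (x B)`
lies in the open lower half-plane. -/
theorem im_neg_or_proportional (h : IsSymmPair d f₁ f₂ A B) (hp : IsInterlacingPair f₁ f₂) {z : ℂ}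
    (hz : 0 < z.im) :
    (aeval z f₂ * (starRingEnd ℂ) (aeval z (X * B))).im < 0 ∨ ∃ κ : ℝ, X * B = C κ * f₂ := by
  have hd2 := h.nonnegLift_right.natDegree_eq h.ne_zero
  have hc : f₂.coeff d ≠ 0 := (h.nonnegLift_right.coeff_pos h.ne_zero).ne'
  -- `D` removes the multiple of `f₂` that carries the coefficient of degree `d`. It is linear,
  -- kills `f₂`, sends `f₁` to `B` and `(x + 1) f₂ / (x - s)` to `(1 + s) f₂ / (x - s)`.
  set D : ℝ[X] → ℝ[X] := fun f => f - C (f.coeff d / f₂.coeff d) * f₂ with hD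
  have hDadd : ∀ f g, D (f + g) = D f + D g := fun f g => by
    simp only [hD, coeff_add, add_div, map_add]
    ring
  have hDmul : ∀ c f, D (C c * f) = C c * D f := fun c f => by
    simp only [hD, coeff_C_mul, mul_div_assoc, map_mul]
    ring
  have hDB : D f₁ = B := by
    simp only [hD, h.coeff_eq, div_self hc, C_1, one_mul, h.left_sub_right]
  have hprop : ∀ {g : ℝ[X]} {κ : ℝ}, g = C κ * f₂ →
      (aeval z f₂ * (starRingEnd ℂ) (aeval z g)).im = 0 := by
    rintro _ κ rfl
    rw [map_mul, aeval_C, Complex.coe_algebraMap, map_mul, Complex.conj_ofReal, mul_left_comm,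
      Complex.mul_conj, ← Complex.ofReal_mul, Complex.ofReal_im]
  have key := hp.cone_induction (fun f =>
    (aeval z f₂ * (starRingEnd ℂ) (aeval z (X * D f))).im < 0 ∨ ∃ κ : ℝ, X * D f = C κ * f₂)
    ?_ ?_ ?_ ?_
  · rwa [hDB] at key
  · intro f g hf hg
    rw [hDadd, mul_add, map_add, map_add, mul_add, Complex.add_im]
    rcases hf with hf | ⟨κ, hf⟩
    · rcases hg with hg | ⟨κ', hg⟩
      · exact .inl (add_neg hf hg)
      · exact .inl (by rw [hprop hg, add_zero]; exact hf)
    · rcases hg with hg | ⟨κ', hg⟩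
      · exact .inl (by rw [hprop hf, zero_add]; exact hg)
      · exact .inr ⟨κ + κ', by rw [hf, hg, C_add, add_mul]⟩
  · intro c f hc0 hf
    rw [hDmul, mul_left_comm]
    rcases hf with hf | ⟨κ, hf⟩
    · rcases eq_or_lt_of_le hc0 with rfl | hc0
      · exact .inr ⟨0, by simp⟩
      · left
        rw [map_mul (aeval z), aeval_C, Complex.coe_algebraMap, map_mul, Complex.conj_ofReal,
          mul_left_comm, Complex.im_ofReal_mul]
        exact mul_neg_of_pos_of_neg hc0 hf
    · exact .inr ⟨c * κ, by rw [hf, C_mul, mul_assoc]⟩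
  · refine .inr ⟨0, ?_⟩
    simp only [hD, div_self hc]
    simp
  · intro s φ e h1 h2 hφ
    have hφd : φ.natDegree < d := by
      rw [← hd2, e, natDegree_mul (X_sub_C_ne_zero s) hφ.ne_zero, natDegree_X_sub_C]
      omega
    have hDφ : D ((X + 1) * φ) = C (1 + s) * φ := by
      have e1 : (X + 1) * φ = f₂ + C (1 + s) * φ := by
        rw [e, C_add, C_1]
        ring
      have e2 : ((X + 1) * φ).coeff d = f₂.coeff d := by
        rw [e1, coeff_add, coeff_C_mul, coeff_eq_zero_of_natDegree_lt hφd, mul_zero, add_zero]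
      simp only [hD, e2, div_self hc]
      rw [e1, C_1]
      ring
    rw [hDφ]
    -- At the endpoints `s = -1` and `s = 0` the polynomial `X * D f` is `0` or `f₂`. In between,
    -- the sign comes from `Im ((z - s) * conj z) = s * Im z`.
    rcases eq_or_lt_of_le h1 with rfl | h1
    · exact .inr ⟨0, by simp⟩
    rcases eq_or_lt_of_le h2 with rfl | h2
    · exact .inr ⟨1, by rw [e]; simp⟩
    left
    have hφz : 0 < Complex.normSq (aeval z φ) :=
      Complex.normSq_pos.2 (hφ.splits.aeval_ne_zero hφ.ne_zero hz.ne')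
    have e3 : aeval z f₂ * (starRingEnd ℂ) (aeval z (X * (C (1 + s) * φ))) =
        (((1 + s) * Complex.normSq (aeval z φ) : ℝ) : ℂ) * ((z - s) * (starRingEnd ℂ) z) := by
      rw [e, Complex.ofReal_mul, ← Complex.mul_conj]
      simp only [map_mul, map_sub, aeval_X, aeval_C, Complex.coe_algebraMap, Complex.conj_ofReal]
      ring
    have e4 : ((z - s) * (starRingEnd ℂ) z).im = s * z.im := by
      simp
      ring
    rw [e3, Complex.im_ofReal_mul, e4]
    exact mul_neg_of_pos_of_neg (mul_pos (by linarith) hφz) (mul_neg_of_neg_of_pos h2 hz)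

theorem im_le_zero (h : IsSymmPair d f₁ f₂ A B) (hp : IsInterlacingPair f₁ f₂) {z : ℂ}
    (hz : 0 < z.im) : (aeval z A * (starRingEnd ℂ) (aeval z (X * B))).im ≤ 0 := by
  have hA : A = f₂ - X * B := by
    rw [h.right_eq]
    ring
  rw [hA, map_sub, sub_mul, Complex.mul_conj, Complex.sub_im, Complex.ofReal_im, sub_zero]
  rcases h.im_neg_or_proportional hp hz with hlt | ⟨κ, hκ⟩
  · exact hlt.le
  · rw [hκ, map_mul, aeval_C, Complex.coe_algebraMap, map_mul, Complex.conj_ofReal, mul_left_comm,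
      Complex.mul_conj, ← Complex.ofReal_mul, Complex.ofReal_im]

/-- At a zero of `A`, `f₂ = x B`, so `f₂ * conj (x B)` is real there. The strict alternative fails,
and proportionality has factor `1`, hence `A = f₂ - x B = 0`. -/
theorem left_eq_zero_or (h : IsSymmPair d f₁ f₂ A B) (hp : IsInterlacingPair f₁ f₂) {z : ℂ}
    (hz : 0 < z.im) (hA : aeval z A = 0) : A = 0 := by
  have hf : aeval z f₂ = aeval z (X * B) := by rw [h.right_eq, map_add, hA, zero_add]
  have hne := hp.right.splits.aeval_ne_zero h.ne_zero hz.ne'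
  rcases h.im_neg_or_proportional hp hz with hlt | ⟨κ, hκ⟩
  · rw [← hf, Complex.mul_conj, Complex.ofReal_im] at hlt
    exact absurd hlt (lt_irrefl _)
  · rw [hκ, map_mul, aeval_C] at hf
    have h1 : ((κ : ℝ) : ℂ) = 1 := by
      have : ((κ : ℂ) - 1) * aeval z f₂ = 0 := by
        rw [sub_mul, one_mul, sub_eq_zero]
        exact hf.symm
      exact sub_eq_zero.1 ((mul_eq_zero.1 this).resolve_right hne)
    have h2 : κ = 1 := by exact_mod_cast h1
    rw [h2, C_1, one_mul] at hκ
    have := h.right_eq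
    rw [hκ] at this
    simpa using this

theorem right_eq_zero_or (h : IsSymmPair d f₁ f₂ A B) (hp : IsInterlacingPair f₁ f₂) {z : ℂ}
    (hz : 0 < z.im) (hB : aeval z B = 0) : B = 0 := by
  have hne := hp.right.splits.aeval_ne_zero h.ne_zero hz.ne'
  rcases h.im_neg_or_proportional hp hz with hlt | ⟨κ, hκ⟩
  · rw [map_mul, hB] at hlt
    simp at hlt
  · have := congrArg (aeval z) hκ
    rw [map_mul, hB, mul_zero, map_mul, aeval_C, eq_comm, mul_eq_zero] at this
    have h1 : κ = 0 := by
      have := this.resolve_right hne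
      simpa using this
    rw [h1] at hκ
    simpa using hκ

end IsSymmPair

/-! ### Palindromic polynomials under `t ↦ 1 / conj t`. -/

section Reciprocal

theorem aeval_eq_pow_mul_of_reflect {a : ℝ[X]} {n : ℕ} (ha : a.natDegree ≤ n)
    (hr : a.reflect n = a) {t : ℂ} (ht : t ≠ 0) : aeval t a = t ^ n * aeval t⁻¹ a := by
  let := invertibleOfNonzero ht
  have := eval₂_reflect_mul_pow (algebraMap ℝ ℂ) t n a ha
  rw [hr, invOf_eq_inv] at this
  rw [aeval_def, aeval_def, ← this, mul_comm]

/-- Both `a` and `t b` are `t^(n + 1)` times their partner, `a` or `b`, at `1 / t`: the extra `t`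
makes up for the lower degree of `b`. Since `1 / conj t` stays in the upper half-plane, the
inequality for `(a, b)` and the reversed one for `(a, t b)` are interchangeable. -/
theorem im_reciprocal {n : ℕ} {a b : ℝ[X]} (ha : a.natDegree ≤ n + 1) (hb : b.natDegree ≤ n)
    (hra : a.reflect (n + 1) = a) (hrb : b.reflect n = b) {t : ℂ} (ht : t ≠ 0) :
    ∃ r : ℝ, 0 < r ∧ (aeval t a * (starRingEnd ℂ) (t * aeval t b)).im =
      -(r * (aeval ((starRingEnd ℂ) t⁻¹) a *
        (starRingEnd ℂ) (aeval ((starRingEnd ℂ) t⁻¹) b)).im) := by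
  refine ⟨Complex.normSq (t ^ (n + 1)), Complex.normSq_pos.2 (pow_ne_zero _ ht), ?_⟩
  have e : aeval t a * (starRingEnd ℂ) (t * aeval t b) = (Complex.normSq (t ^ (n + 1)) : ℂ) *
      (starRingEnd ℂ) (aeval ((starRingEnd ℂ) t⁻¹) a *
        (starRingEnd ℂ) (aeval ((starRingEnd ℂ) t⁻¹) b)) := by
    rw [aeval_conj, aeval_conj, aeval_eq_pow_mul_of_reflect ha hra ht,
      aeval_eq_pow_mul_of_reflect hb hrb ht, ← Complex.mul_conj]
    simp only [map_mul, map_pow, Complex.conj_conj]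
    ring
  rw [e, Complex.im_ofReal_mul, Complex.conj_im, mul_neg]

end Reciprocal

end SymmetricPairs

/-! ### Passing between decompositions and interlacing pairs. -/

section Decomposition

theorem reflect_succ_X_mul {n : ℕ} {b : ℝ[X]} (hb : b.natDegree ≤ n) :
    (X * b).reflect (n + 1) = b.reflect n := by
  rw [add_comm, reflect_mul X b natDegree_X_le hb, ← pow_one (X : ℝ[X]), reflect_monomial,
    revAt_le le_rfl]
  simp

theorem div_add_one_im_pos {z : ℂ} (hz : 0 < z.im) : z + 1 ≠ 0 ∧ 0 < (z / (z + 1)).im := by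
  have h1 : 0 < (z + 1).im := by simpa using hz
  have h0 : z + 1 ≠ 0 := fun h => by
    rw [h] at h1
    simp at h1
  refine ⟨h0, ?_⟩
  have : z / (z + 1) = 1 - (z + 1)⁻¹ := by
    field_simp
    ring
  rw [this, Complex.sub_im, Complex.one_im]
  linarith [inv_im_neg h1]

theorem exists_div_add_one_eq {t : ℂ} (ht : 0 < t.im) :
    ∃ z : ℂ, 0 < z.im ∧ z + 1 ≠ 0 ∧ z / (z + 1) = t := by
  have h1 : (0 : ℝ) < (t - 1).im := by simpa using ht
  have h0 : t - 1 ≠ 0 := fun h => by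
    rw [h] at h1
    simp at h1
  have h2 : -(t - 1)⁻¹ - 1 + 1 = -(t - 1)⁻¹ := by ring
  refine ⟨-(t - 1)⁻¹ - 1, ?_, ?_, ?_⟩
  · simpa using inv_im_neg h1
  · rw [h2]
    exact neg_ne_zero.2 (inv_ne_zero h0)
  · rw [h2]
    field_simp
    ring

theorem conj_inv_im_pos {t : ℂ} (ht : 0 < t.im) : 0 < ((starRingEnd ℂ) t⁻¹).im := by
  rw [Complex.conj_im]
  linarith [inv_im_neg ht]

theorem ne_zero_of_im_pos {t : ℂ} (ht : 0 < t.im) : t ≠ 0 := by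
  rintro rfl
  simp at ht

namespace IsSymmDecomp

variable {d : ℕ} {h a b : ℝ[X]}

theorem natDegree_left (H : IsSymmDecomp d h a b) : a.natDegree ≤ d :=
  natDegree_le_of_degree_le H.degree_left

theorem eq_zero_or (H : IsSymmDecomp d h a b) : b = 0 ∨ ∃ n, d = n + 1 ∧ b.natDegree ≤ n := by
  rcases eq_or_ne b 0 with hb | hb
  · exact .inl hb
  · have := (natDegree_lt_iff_degree_lt hb).2 H.degree_right
    exact .inr ⟨d - 1, by omega, by omega⟩

theorem im_mul_nonneg (H : IsSymmDecomp d h a b)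
    (him : ∀ t : ℂ, 0 < t.im → 0 ≤ (aeval t a * (starRingEnd ℂ) (aeval t b)).im) {t : ℂ}
    (ht : 0 < t.im) : 0 ≤ (t * aeval t b * (starRingEnd ℂ) (aeval t a)).im := by
  rcases H.eq_zero_or with rfl | ⟨n, rfl, hb⟩
  · simp
  · obtain ⟨r, hr, e⟩ := im_reciprocal H.natDegree_left hb H.reflect_left H.reflect_right
      (ne_zero_of_im_pos ht)
    have h1 := mul_nonneg hr.le (him _ (conj_inv_im_pos ht))
    have h2 : t * aeval t b * (starRingEnd ℂ) (aeval t a) =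
        (starRingEnd ℂ) (aeval t a * (starRingEnd ℂ) (t * aeval t b)) := by
      simp only [map_mul, Complex.conj_conj]
      ring
    rw [h2, Complex.conj_im, e]
    linarith

theorem natDegree_le (H : IsSymmDecomp d h a b) : h.natDegree ≤ d := by
  rw [H.eq_add]
  refine natDegree_add_le_of_degree_le H.natDegree_left ?_
  rcases H.eq_zero_or with rfl | ⟨n, rfl, hb⟩
  · simp
  · have := natDegree_mul_le (p := (X : ℝ[X])) (q := b)
    rw [natDegree_X] at this
    omega

theorem exists_isInterlacingPair (H : IsSymmDecomp d h a b) (ha : ∀ i, 0 ≤ a.coeff i)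
    (hb : ∀ i, 0 ≤ b.coeff i) (hI : Interlaces b a) (h0 : lift d h ≠ 0) :
    ∃ f₁ A B, IsSymmPair d f₁ (lift d h) A B ∧ IsInterlacingPair f₁ (lift d h) := by
  have him : ∀ t : ℂ, 0 < t.im → 0 ≤ (aeval t a * (starRingEnd ℂ) (aeval t b)).im :=
    fun t ht => hI.im_nonneg ha hb ht
  have hB : ∃ B, lift d (X * b) = X * B ∧ lift d b = (X + 1) * B ∧
      (B = 0 ∨ ∃ e, d = e + 1 ∧ IsNonnegLift e B) ∧ h.reflect d = a + b ∧ b.natDegree ≤ d := by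
    rcases H.eq_zero_or with hb0 | ⟨n, rfl, hbn⟩
    · refine ⟨0, by simp [hb0], by simp [hb0], .inl rfl, ?_, by simp [hb0]⟩
      rw [H.eq_add, hb0, mul_zero, add_zero, H.reflect_left]
    · refine ⟨lift n b, lift_succ_X_mul n b, lift_succ n hbn,
        .inr ⟨n, rfl, b, hbn, hb, rfl⟩, ?_, by omega⟩
      rw [H.eq_add, reflect_add, H.reflect_left, reflect_succ_X_mul hbn]
      congr 1
      exact H.reflect_right
  obtain ⟨B, hB1, hB2, hB3, hB4, hB5⟩ := hB
  have hS : IsSymmPair d (lift d (a + b)) (lift d h) (lift d a) B :=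
    ⟨by rw [lift_add, hB2], by rw [H.eq_add, lift_add, hB1], ⟨a, H.natDegree_left, ha, rfl⟩, hB3,
      by rw [← hB4, lift_reflect], h0⟩
  have e2 : ∀ t : ℂ, aeval t h = aeval t a + t * aeval t b := fun t => by
    rw [H.eq_add, map_add, map_mul, aeval_X]
  refine ⟨_, _, B, hS, hS.isInterlacingPair (fun z hz => ?_) fun z hz => ?_⟩
  · obtain ⟨h1, ht⟩ := div_add_one_im_pos hz
    rw [aeval_lift H.natDegree_le z h1]
    set t := z / (z + 1)
    refine mul_ne_zero (pow_ne_zero _ h1) fun he => ?_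
    rw [e2] at he
    -- Here `a * conj b = -t |b|^2` would have negative imaginary part unless `b(t) = 0`. Then `a(t)
    -- = 0` too, and real-rootedness makes both polynomials zero.
    have hα : aeval t a = -(t * aeval t b) := eq_neg_of_add_eq_zero_left he
    have hβ : aeval t b = 0 := by
      by_contra hne
      have := him t ht
      rw [hα, neg_mul, mul_assoc, Complex.mul_conj, Complex.neg_im, mul_comm,
        Complex.im_ofReal_mul] at this
      have := mul_pos (Complex.normSq_pos.2 hne) ht
      linarith
    rw [hβ, mul_zero, neg_zero] at hα
    have hb0 : b = 0 := by
      by_contra hne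
      exact hI.1.aeval_ne_zero hne ht.ne' hβ
    have ha0 : a = 0 := by
      by_contra hne
      exact hI.2.1.aeval_ne_zero hne ht.ne' hα
    rw [H.eq_add, ha0, hb0, mul_zero, add_zero, lift_zero] at h0
    exact h0 rfl
  · obtain ⟨h1, ht⟩ := div_add_one_im_pos hz
    rw [aeval_lift H.natDegree_le z h1,
      aeval_lift (natDegree_add_le_of_degree_le H.natDegree_left hB5) z h1]
    set t := z / (z + 1)
    rw [map_mul, mul_mul_mul_comm, Complex.mul_conj, Complex.im_ofReal_mul]
    refine mul_nonneg (Complex.normSq_nonneg _) ?_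
    -- Each of the four summands has nonnegative imaginary part; the third does by palindromicity
    -- (`im_mul_nonneg`).
    have e : aeval t h * (starRingEnd ℂ) (aeval t (a + b)) =
        (Complex.normSq (aeval t a) : ℂ) + aeval t a * (starRingEnd ℂ) (aeval t b) +
          t * aeval t b * (starRingEnd ℂ) (aeval t a) + (Complex.normSq (aeval t b) : ℂ) * t := by
      rw [e2, map_add, map_add, ← Complex.mul_conj, ← Complex.mul_conj]
      ring
    rw [e, Complex.add_im, Complex.add_im, Complex.add_im, Complex.ofReal_im,
      Complex.im_ofReal_mul]
    have h3 := H.im_mul_nonneg him ht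
    have h4 := him t ht
    have h5 := mul_nonneg (Complex.normSq_nonneg (aeval t b)) ht.le
    linarith

end IsSymmDecomp

theorem IsSymmPair.exists_decomp {d : ℕ} {f₁ f₂ A B : ℝ[X]} (h : IsSymmPair d f₁ f₂ A B)
    (hp : IsInterlacingPair f₁ f₂) :
    ∃ H : ℝ[X], H.natDegree ≤ d ∧ lift d H = f₂ ∧ HasNonnegInterlacingSymmDecomp d H := by
  obtain ⟨a, had, ha, hA⟩ := h.nonneg_left
  have hsplit : ∀ {n : ℕ} {q Q : ℝ[X]}, q.natDegree ≤ n → Q = lift n q →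
      (∀ z : ℂ, 0 < z.im → aeval z Q = 0 → Q = 0) → q.Splits := by
    intro n q Q hq hQ hz
    rcases eq_or_ne q 0 with rfl | hq0
    · exact Splits.zero
    refine splits_of_aeval_ne_zero fun t ht h0 => hq0 ?_
    obtain ⟨z, hz1, hz2, rfl⟩ := exists_div_add_one_eq ht
    refine lift_injective (d := n) hq (by simp) ?_
    rw [← hQ, lift_zero]
    exact hz z hz1 (by rw [hQ, aeval_lift hq z hz2, h0, mul_zero])
  have hAcomp : (-1) ^ d * A.comp (-1 - X) = A := by
    -- In this form the symmetry of `A` is visible: `x ↦ -1 - x` exchanges `f₁` and `f₂` up to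
    -- `(-1)^d`, and `x` with `-(x + 1)`.
    have e : A = (X + 1) * f₂ - X * f₁ := by
      rw [h.left_eq, h.right_eq]
      ring
    have e' : A.comp (-1 - X) = -X * f₂.comp (-1 - X) + (X + 1) * f₁.comp (-1 - X) := by
      conv_lhs => rw [e]
      simp only [sub_comp, mul_comp, add_comp, X_comp, one_comp]
      ring
    rw [e', e]
    linear_combination X * h.left_comp - (X + 1) * h.right_comp
  have hra : a.reflect d = a := by
    refine lift_injective (natDegree_reflect_le.trans (max_le le_rfl had)) had ?_
    rw [lift_reflect, ← hA, hAcomp]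
  have hsa : a.Splits := hsplit had hA fun z => h.left_eq_zero_or hp
  rcases h.nonneg_right with hB | ⟨n, rfl, b, hbd, hb, hB⟩
  · refine ⟨a, had, ?_, a, 0, ⟨by simp, degree_le_of_natDegree_le had, hra, ?_, by simp⟩, ha,
      by simp, Splits.zero, hsa, .inl rfl⟩
    · rw [h.right_eq, hB, hA, mul_zero, add_zero]
    · rw [degree_zero]
      exact WithBot.bot_lt_coe d
  · have hrb : b.reflect n = b := by
      refine lift_injective (natDegree_reflect_le.trans (max_le le_rfl hbd)) hbd ?_
      rw [lift_reflect, ← hB, ← h.left_sub_right, sub_comp]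
      have h1 := h.left_comp
      have h2 := h.right_comp
      rw [pow_succ] at h1 h2
      linear_combination h2 - h1
    have hbdeg : b.degree < ((n + 1 : ℕ) : WithBot ℕ) :=
      lt_of_le_of_lt (degree_le_of_natDegree_le hbd) (by exact_mod_cast Nat.lt_succ_self n)
    have hD : IsSymmDecomp (n + 1) (a + X * b) a b :=
      ⟨rfl, degree_le_of_natDegree_le had, hra, hbdeg, hrb⟩
    refine ⟨a + X * b, hD.natDegree_le, ?_, a, b, hD, ha, hb, interlaces_of_im_nonneg hsa
      (hsplit hbd hB fun z => h.right_eq_zero_or hp) ha hb fun τ hτ => ?_⟩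
    · rw [lift_add, lift_succ_X_mul, ← hA, ← hB, h.right_eq]
    · have hle : ∀ t : ℂ, 0 < t.im →
          (aeval t a * (starRingEnd ℂ) (t * aeval t b)).im ≤ 0 := by
        intro t ht
        obtain ⟨z, hz1, hz2, rfl⟩ := exists_div_add_one_eq ht
        have := h.im_le_zero hp hz1
        have e : aeval z A * (starRingEnd ℂ) (aeval z (X * B)) =
            (Complex.normSq ((z + 1) ^ (n + 1)) : ℂ) * (aeval (z / (z + 1)) a *
              (starRingEnd ℂ) (z / (z + 1) * aeval (z / (z + 1)) b)) := by
          have e1 : aeval z (X * B) = (z + 1) ^ (n + 1) *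
              (z / (z + 1) * aeval (z / (z + 1)) b) := by
            rw [map_mul, aeval_X, hB, aeval_lift hbd z hz2]
            field_simp
            ring
          rw [e1, hA, aeval_lift had z hz2, ← Complex.mul_conj, map_mul]
          ring
        rw [e, Complex.im_ofReal_mul] at this
        exact nonpos_of_mul_nonpos_right this
          (Complex.normSq_pos.2 (pow_ne_zero _ hz2))
      -- `im_le_zero` concerns the pair `(a, t b)`; using it at `t = 1 / conj τ` turns it into the
      -- required inequality for `(a, b)` at `τ`.
      have ht := conj_inv_im_pos hτ
      obtain ⟨r, hr, e⟩ := im_reciprocal had hbd hra hrb (ne_zero_of_im_pos ht)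
      have h1 := hle _ ht
      rw [e] at h1
      have e2 : (starRingEnd ℂ) ((starRingEnd ℂ) τ⁻¹)⁻¹ = τ := by simp
      rw [e2] at h1
      exact nonneg_of_mul_nonneg_right (by linarith) hr

end Decomposition

theorem theorem1p5 (p q : ℝ[X])
    (hp : HasNonnegInterlacingSymmDecomp p.natDegree (numeratorPoly p))
    (hq : HasNonnegInterlacingSymmDecomp q.natDegree (numeratorPoly q)) :
    HasNonnegInterlacingSymmDecomp (p * q).natDegree (numeratorPoly (p * q)) := by
  -- The zero product is separate: degrees are not additive there, and the lifts must be nonzero to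
  -- form interlacing pairs.
  by_cases h0 : p * q = 0
  · have hW : numeratorPoly (0 : ℝ[X]) = 0 := by
      apply Polynomial.coe_injective ℝ
      rw [coe_numeratorPoly]
      ext n
      simp [show (PowerSeries.mk fun _ : ℕ => (0 : ℝ)) = 0 from rfl]
    rw [h0, hW]
    exact ⟨0, 0, ⟨by simp, by simp, by simp, by simp, by simp⟩, by simp, by simp,
      Splits.zero, Splits.zero, .inl rfl⟩
  · obtain ⟨hp0, hq0⟩ := mul_ne_zero_iff.1 h0
    obtain ⟨a, b, hab, ha, hb, hI⟩ := hp
    obtain ⟨a', b', hab', ha', hb', hI'⟩ := hq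
    obtain ⟨f₁, A, B, hS, hP⟩ :=
      hab.exists_isInterlacingPair ha hb hI (lift_numeratorPoly_ne_zero hp0)
    obtain ⟨g₁, A', B', hS', hP'⟩ :=
      hab'.exists_isInterlacingPair ha' hb' hI' (lift_numeratorPoly_ne_zero hq0)
    have hst : ∀ z : ℂ, 0 < z.im → aeval z (diamond (lift p.natDegree (numeratorPoly p))
        (lift q.natDegree (numeratorPoly q))) ≠ 0 := fun z hz =>
      hP.right.aeval_diamond_ne_zero hP'.right hz
    have hS'' := hS.diamond hS' fun h => hst Complex.I (by simp) (by rw [h, map_zero])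
    obtain ⟨H, hd, hH, hdec⟩ := hS''.exists_decomp
      (hS''.isInterlacingPair hst fun z hz => hP.im_diamond_nonneg hP' hz)
    rw [numeratorPoly_mul_eq hp0 hq0 hd hH, natDegree_mul hp0 hq0]
    exact hdec
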